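/- **Problem.** An instance of bin packing with general cost structures consists of $n$ items with sizes $1\ge s_1\ge s_2\ge\dots\ge s_n\ge 0$ and a valid cost function $f:\{0,\dots,n\}\to\mathbb R$, that is, $f$ is non-decreasing and concave with $f(0)=0$. A packing is a partition of the items into bins $S_1,\dots,S_m$ with $\sum_{j\in S_i}s_j\le 1$ for every $i$; its cost is $\sum_{i}f(|S_i|)$, and $\mathrm{OPT}$ is the minimum cost of a packing. The asymptotic approximation ratio of an algorithm is the infimum of all $R\ge 1$ for which there is a constant $c$, independent of the instance, such that the cost of the algorithm's packing is at most $R\cdot\mathrm{OPT}+c$ on every instance; here $f$ is either normalized by $f(1)=1$, or fixed. **Weights.** Let $\pi_1=2$ and $\pi_{i+1}=\pi_i(\pi_i-1)+1$. Let $w(0)=0$, and for $p\in(\frac1{k+1},\frac1k]$ with $k\geq 1$ an integer let $w(p)=\frac1k$ if $k=\pi_i-1$ for some $i\ge1$, and $w(p)=\frac{k+1}{k}\,p$ otherwise. **Algorithm MatchHalf** (it does not depend on $f$). Let $t$ be the number of items of size larger than $\frac12$ (large items $1,\dots,t$). Consider the bipartite graph between the $\lceil t/2\rceil$ smallest large items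 $\lceil\frac{t+1}2\rceil,\dots,t$ and the small items $t+1,\dots,n$, in which $a$ and $b$ are adjacent if $s_a+s_b\le1$; the edge between a large item $a$ and a small item $b$ has weight $w(s_b)$. Choose any matching of maximum weight and pack each matched pair into a bin of its own. Pack the remaining items by Next Fit Increasing: in the order of non-decreasing sizes (decreasing indices), put each item into the current bin if it fits, and otherwise close this bin and open a new one. **Theorem.** MatchHalf always outputs a packing (a maximum weight matching exists, and each choice of it leads to a packing), and its asymptotic approximation ratio is at most $\frac32$ for all valid cost functions simultaneously: the ratio is at most $\frac32$ over all instances with a valid cost function with $f(1)=1$, and also for every fixed non-decreasing concave $f:\{0,1,2,\dots\}\to\mathbb R$ with $f(0)=0$. Moreover, there is one constant $c$ such that for every $n\ge1$, all sizes, every valid $f$ and every choice of the matching, the cost of the packing of MatchHalf is at most $\frac32\,\mathrm{OPT}+c\,f(1)$. -/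

import Mathlib

/- Items of an input with `n` items are the elements of `Fin n` (item `i` of `1, …, n` is the
element `i - 1` of `Fin n`). An input is the vector `s` of sizes, sorted in non-increasing order. -/

namespace GCBP

/-- The size vector of an input: `1 ≥ s₁ ≥ s₂ ≥ ⋯ ≥ sₙ ≥ 0`. -/
def IsInput {n : ℕ} (s : Fin n → ℝ) : Prop :=
  Antitone s ∧ ∀ i, 0 ≤ s i ∧ s i ≤ 1

/-- A cost function on `{0, …, n}` that is non-decreasing and concave with `f 0 = 0`
(values of `f` beyond `n` are never used). -/
structure Valid (n : ℕ) (f : ℕ → ℝ) : Prop where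
  map_zero : f 0 = 0
  mono : ∀ i j, i ≤ j → j ≤ n → f i ≤ f j
  concave : ∀ i, i + 2 ≤ n → f (i + 2) - f (i + 1) ≤ f (i + 1) - f i

/-- A partition of the items into non-empty bins. -/
abbrev Partition (n : ℕ) := Finpartition (Finset.univ : Finset (Fin n))

/-- The partition is a packing: every bin has total size at most `1`. -/
def IsPacking {n : ℕ} (s : Fin n → ℝ) (P : Partition n) : Prop :=
  ∀ B ∈ P.parts, ∑ i ∈ B, s i ≤ 1

/-- The cost of a partition with respect to `f`: the sum of `f (|B|)` over its bins. -/
def cost {n : ℕ} (f : ℕ → ℝ) (P : Partition n) : ℝ :=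
  ∑ B ∈ P.parts, f B.card

/-- The minimum cost of a packing. -/
noncomputable def opt {n : ℕ} (f : ℕ → ℝ) (s : Fin n → ℝ) : ℝ :=
  sInf (cost f '' {P : Partition n | IsPacking s P})

/-- On every input, `opt` is the cost of a cheapest packing. -/
theorem opt_isLeast {n : ℕ} (f : ℕ → ℝ) (s : Fin n → ℝ) (hs : IsInput s) :
    IsLeast (cost f '' {P : Partition n | IsPacking s P}) (opt f s) := by
  have hfin : (cost f '' {P : Partition n | IsPacking s P}).Finite := Set.toFinite _
  have hne : (cost f '' {P : Partition n | IsPacking s P}).Nonempty := by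
    refine Set.Nonempty.image _ ⟨⊥, ?_⟩
    intro B hB
    rw [Finpartition.mem_bot_iff] at hB
    obtain ⟨a, -, rfl⟩ := hB
    simpa using (hs.2 a).2
  exact ⟨hne.csInf_mem hfin, fun x hx => csInf_le hfin.bddBelow hx⟩

/-- A heuristic that does not use the cost function: for every size vector, the set of the
partitions that it may output (it may make arbitrary choices). -/
abbrev Heuristic := ∀ {n : ℕ}, (Fin n → ℝ) → Set (Partition n)

/-- `R ≥ 1` is such that for some constant `c`, which does not depend on the instance
(the number of items, their sizes, and the cost function, which is taken from the class `F n` if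
there are `n` items), every output has cost at most `R * OPT + c`. -/
def IsAsymptoticBound (A : Heuristic) (F : ℕ → Set (ℕ → ℝ)) (R : ℝ) : Prop :=
  1 ≤ R ∧ ∃ c : ℝ, ∀ (n : ℕ) (s : Fin n → ℝ), IsInput s → ∀ f ∈ F n, ∀ P ∈ A s,
    cost f P ≤ R * opt f s + c

/-- The asymptotic approximation ratio: the infimum of the numbers `R ≥ 1` as above
(`⊤` if there are none). -/
noncomputable def asymptoticRatio (A : Heuristic) (F : ℕ → Set (ℕ → ℝ)) : EReal :=
  sInf ((fun R : ℝ => (R : EReal)) '' {R : ℝ | IsAsymptoticBound A F R})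

/-- The sequence `2, 3, 7, 43, …` with `π (i + 1) = π i * (π i - 1) + 1`. -/
def piSeq : ℕ → ℕ
  | 0 => 2
  | i + 1 => piSeq i * (piSeq i - 1) + 1

open scoped Classical in
/-- The weight function `w`. For `p > 0`, the number `k = ⌊1 / p⌋` is the one with
`1 / (k + 1) < p ≤ 1 / k`. -/
noncomputable def weight (p : ℝ) : ℝ :=
  if p ≤ 0 then 0
  else if ∃ i, ⌊1 / p⌋₊ = piSeq i - 1 then 1 / (⌊1 / p⌋₊ : ℝ)
  else ((⌊1 / p⌋₊ : ℝ) + 1) / (⌊1 / p⌋₊ : ℝ) * p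

/-- The number `t` of large items, i.e. items of size larger than `1/2`; as the sizes are sorted,
these are the first `t` items. -/
noncomputable def numLarge {n : ℕ} (s : Fin n → ℝ) : ℕ :=
  (Finset.univ.filter fun i => 1 / 2 < s i).card

/-- A matching between the `⌈t/2⌉` smallest large items (the items `⌈(t+1)/2⌉, …, t` in
one-based numbering) and the small items `t + 1, …, n`, given as a set of pairs (large, small).
A large and a small item may be matched if they fit together into a bin. -/
structure IsMatching {n : ℕ} (s : Fin n → ℝ) (M : Finset (Fin n × Fin n)) : Prop where
  large : ∀ e ∈ M, numLarge s / 2 ≤ (e.1 : ℕ) ∧ (e.1 : ℕ) < numLarge s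
  small : ∀ e ∈ M, numLarge s ≤ (e.2 : ℕ)
  fits : ∀ e ∈ M, s e.1 + s e.2 ≤ 1
  inj_large : ∀ e ∈ M, ∀ e' ∈ M, e.1 = e'.1 → e = e'
  inj_small : ∀ e ∈ M, ∀ e' ∈ M, e.2 = e'.2 → e = e'

/-- A matching that maximizes the total weight `w` of the matched small items. -/
def IsMaxMatching {n : ℕ} (s : Fin n → ℝ) (M : Finset (Fin n × Fin n)) : Prop :=
  IsMatching s M ∧
    ∀ M', IsMatching s M' → ∑ e ∈ M', weight (s e.2) ≤ ∑ e ∈ M, weight (s e.2)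

/-- Next Fit with the current open bin `B`: the next item is put into `B` if it fits; otherwise
`B` is closed for good and a new bin is opened for the item. -/
noncomputable def nextFitFrom {n : ℕ} (s : Fin n → ℝ) :
    Finset (Fin n) → List (Fin n) → List (Finset (Fin n))
  | B, [] => [B]
  | B, i :: l =>
    if (∑ j ∈ B, s j) + s i ≤ 1 then nextFitFrom s (insert i B) l
    else B :: nextFitFrom s {i} l

/-- The bins created by Next Fit on a list of items. -/
noncomputable def nextFit {n : ℕ} (s : Fin n → ℝ) : List (Fin n) → List (Finset (Fin n))
  | [] => []
  | i :: l => nextFitFrom s {i} l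

/-- Next Fit Increasing on a set `J` of items: Next Fit in the order of non-decreasing sizes,
that is, of decreasing indices. -/
noncomputable def nextFitIncreasing {n : ℕ} (s : Fin n → ℝ) (J : Finset (Fin n)) :
    List (Finset (Fin n)) :=
  nextFit s (J.sort (· ≥ ·))

/-- The items covered by a set of pairs. -/
def matched {n : ℕ} (M : Finset (Fin n × Fin n)) : Finset (Fin n) :=
  M.image Prod.fst ∪ M.image Prod.snd

/-- The bins of MatchHalf with the matching `M`: one bin for every matched pair, and the bins of
Next Fit Increasing on the remaining items. -/
noncomputable def matchHalfBins {n : ℕ} (s : Fin n → ℝ) (M : Finset (Fin n × Fin n)) :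
    Finset (Finset (Fin n)) :=
  M.image (fun e => {e.1, e.2}) ∪ (nextFitIncreasing s (Finset.univ \ matched M)).toFinset

/-- The algorithm MatchHalf; it may choose any maximum weight matching. -/
def matchHalf : Heuristic := fun s =>
  {P | ∃ M, IsMaxMatching s M ∧ P.parts = matchHalfBins s M}

end GCBP

namespace GCBP

/-! A valid cost function is a non-negative combination of the truncations `min j k`, with
coefficients summing to `f 1` (`Valid.exists_coeff`). MatchHalf does not see the cost function, so
it suffices to bound its cost by 3/2 times that of an arbitrary packing `O`, plus 13, for each
truncation separately. Let `t` be the number of large items.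

For `k = 1` the cost is the number of bins. Next Fit Increasing opens at most as many bins as the
total weight of its items, plus 12 (`length_nextFitIncreasing_le`): a bounded potential pays for
closed bins in which the size class changes. A matched pair saves the weight of its small item. In
`O`, each large item may have a largest companion, and the maximum matching has at least half of the
total weight of these companions, up to 1/2 (`exists_isMatching_of_partners`). Crediting each bin of
`O` with half the weight of its companion leaves weight at most 3/2 per bin (`sum_weight_erase_le`).

For `k ≥ 2`, Next Fit Increasing is charged to sizes scaled by `q` and truncated at 1: a bin closed
while only items of size at most `1 / q` have arrived, the next one included, has scaled size at
least `q - 1`; once all remaining items are larger, they cost at most 1 each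
(`truncCost_nextFitIncreasing_le_mul`). The matching has at most `(t + 1) / 2` edges, so its extra
cost is paid by half of the large items. Taking `q = 3` for `k = 2`, and `q = k` for `k ≥ 3`, gives
the factor 3/2. If `k ≥ 3`, few bins hold small items and `O` has at most one bin with `k` or more
items, the argument uses instead that the first bin of Next Fit Increasing has maximum cardinality
(`exists_card_le_nextFitIncreasing`). -/

/-! ### Next Fit on non-decreasing sizes -/

/-- The state of Next Fit with open bin `B` and remaining items `l`, when the items arrive in the
order of non-decreasing sizes. -/
structure Ready {n : ℕ} (s : Fin n → ℝ) (B : Finset (Fin n)) (l : List (Fin n)) : Prop where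
  le : ∀ b ∈ B, ∀ i ∈ l, s b ≤ s i
  notMem : ∀ i ∈ l, i ∉ B
  sorted : l.Pairwise (fun i j => s i ≤ s j)
  nodup : l.Nodup

section NextFit

variable {n : ℕ} {s : Fin n → ℝ} {B : Finset (Fin n)} {l : List (Fin n)} {i : Fin n}

theorem Ready.insert (h : Ready s B (i :: l)) : Ready s (insert i B) l := by
  have h3 := List.pairwise_cons.1 h.sorted
  have h4 := List.nodup_cons.1 h.nodup
  refine ⟨fun b hb j hj => ?_, fun j hj hjB => ?_, h3.2, h4.2⟩
  · rcases Finset.mem_insert.1 hb with rfl | hb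
    · exact h3.1 j hj
    · exact h.le b hb j (List.mem_cons_of_mem _ hj)
  · rcases Finset.mem_insert.1 hjB with rfl | hjB
    · exact h4.1 hj
    · exact h.notMem j (List.mem_cons_of_mem _ hj) hjB

theorem Ready.singleton (h : (i :: l).Pairwise (fun i j => s i ≤ s j)) (h' : (i :: l).Nodup) :
    Ready s {i} l := by
  have h3 := List.pairwise_cons.1 h
  have h4 := List.nodup_cons.1 h'
  refine ⟨fun b hb j hj => ?_, fun j hj hjB => ?_, h3.2, h4.2⟩
  · rw [Finset.mem_singleton.1 hb]
    exact h3.1 j hj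
  · rw [Finset.mem_singleton.1 hjB] at hj
    exact h4.1 hj

theorem Ready.next (h : Ready s B (i :: l)) : Ready s {i} l :=
  Ready.singleton h.sorted h.nodup

theorem Ready.head_notMem (h : Ready s B (i :: l)) : i ∉ B :=
  h.notMem i List.mem_cons_self

theorem Ready.le_tail (h : Ready s B (i :: l)) : ∀ j ∈ i :: l, s i ≤ s j := by
  intro j hj
  rcases List.mem_cons.1 hj with rfl | hj
  · exact le_rfl
  · exact (List.pairwise_cons.1 h.sorted).1 j hj

theorem mem_nextFitFrom {x : Fin n} (l : List (Fin n)) (B : Finset (Fin n)) :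
    (∃ X ∈ nextFitFrom s B l, x ∈ X) ↔ x ∈ B ∨ x ∈ l := by
  induction l generalizing B with
  | nil => simp [nextFitFrom]
  | cons i l ih =>
    rw [nextFitFrom]
    split_ifs
    · rw [ih]
      simp only [Finset.mem_insert, List.mem_cons]
      tauto
    · simp only [List.mem_cons, exists_eq_or_imp, ih, Finset.mem_singleton]

theorem nextFitFrom_bins (h1 : ∀ i, s i ≤ 1) (l : List (Fin n)) (B : Finset (Fin n))
    (hB : B.Nonempty) (hs : ∑ j ∈ B, s j ≤ 1) (h : Ready s B l) :
    (∀ X ∈ nextFitFrom s B l, X.Nonempty ∧ ∑ j ∈ X, s j ≤ 1) ∧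
      (nextFitFrom s B l).Pairwise Disjoint := by
  induction l generalizing B with
  | nil => simp [nextFitFrom, hB, hs]
  | cons i l ih =>
    rw [nextFitFrom]
    split_ifs with hf
    · refine ih _ (Finset.insert_nonempty _ _) ?_ h.insert
      rw [Finset.sum_insert h.head_notMem]
      linarith
    · obtain ⟨ih1, ih2⟩ := ih {i} (Finset.singleton_nonempty _) (by simpa using h1 i) h.next
      refine ⟨?_, List.pairwise_cons.2 ⟨fun X hX => ?_, ih2⟩⟩
      · intro X hX
        rcases List.mem_cons.1 hX with rfl | hX
        · exact ⟨hB, hs⟩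
        · exact ih1 X hX
      · rw [Finset.disjoint_right]
        intro x hx hxB
        have := (mem_nextFitFrom (s := s) l {i}).1 ⟨X, hX, hx⟩
        refine h.notMem x ?_ hxB
        simpa using this

theorem sort_sorted (hs : Antitone s) (J : Finset (Fin n)) :
    (J.sort (· ≥ ·)).Pairwise (fun i j => s i ≤ s j) :=
  (J.pairwise_sort (· ≥ ·)).imp fun h => hs h

theorem mem_nextFitIncreasing {x : Fin n} (J : Finset (Fin n)) :
    (∃ X ∈ nextFitIncreasing s J, x ∈ X) ↔ x ∈ J := by
  rw [nextFitIncreasing, ← Finset.mem_sort (s := J) (· ≥ ·)]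
  cases J.sort (· ≥ ·) with
  | nil => simp [nextFit]
  | cons i l => simp [nextFit, mem_nextFitFrom]

theorem nextFitIncreasing_bins (hs : IsInput s) (J : Finset (Fin n)) :
    (∀ X ∈ nextFitIncreasing s J, X.Nonempty ∧ ∑ j ∈ X, s j ≤ 1) ∧
      (nextFitIncreasing s J).Pairwise Disjoint := by
  rw [nextFitIncreasing]
  have h1 := sort_sorted hs.1 J
  have h2 := J.sort_nodup (· ≥ ·)
  revert h1 h2
  cases J.sort (· ≥ ·) with
  | nil => simp [nextFit]
  | cons i l =>
    intro h1 h2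
    exact nextFitFrom_bins (fun i => (hs.2 i).2) l {i} (Finset.singleton_nonempty _)
      (by simpa using (hs.2 i).2) (Ready.singleton h1 h2)

end NextFit

/-! ### Matchings, and MatchHalf as a packing -/

section Matching

variable {n : ℕ} {s : Fin n → ℝ} {M : Finset (Fin n × Fin n)}

theorem exists_isMaxMatching (s : Fin n → ℝ) : ∃ M, IsMaxMatching s M := by
  obtain ⟨M, hM, hmax⟩ := Set.exists_max_image {M | IsMatching s M}
    (fun M => ∑ e ∈ M, weight (s e.2)) (Set.toFinite _) ⟨∅, by constructor <;> simp⟩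
  exact ⟨M, hM, hmax⟩

theorem IsMatching.ne (hM : IsMatching s M)
    {e e' : Fin n × Fin n} (he : e ∈ M) (he' : e' ∈ M) : e.1 ≠ e'.2 := by
  intro h
  have h1 := (hM.large e he).2
  have h2 := hM.small e' he'
  rw [h] at h1
  omega

theorem mem_matched {x : Fin n} : x ∈ matched M ↔ ∃ e ∈ M, x = e.1 ∨ x = e.2 := by
  simp only [matched, Finset.mem_union, Finset.mem_image]
  grind

theorem exists_partition_matchHalfBins (hs : IsInput s) (hM : IsMatching s M) :
    ∃ P : Partition n, P.parts = matchHalfBins s M ∧ IsPacking s P := by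
  obtain ⟨hN, hD⟩ := nextFitIncreasing_bins hs (Finset.univ \ matched M)
  have hmem : ∀ X, X ∈ matchHalfBins s M ↔
      (∃ e ∈ M, {e.1, e.2} = X) ∨ X ∈ nextFitIncreasing s (Finset.univ \ matched M) := by
    intro X
    simp only [matchHalfBins, Finset.mem_union, Finset.mem_image, List.mem_toFinset]
  have hpm : ∀ e ∈ M, ∀ X ∈ nextFitIncreasing s (Finset.univ \ matched M),
      Disjoint ({e.1, e.2} : Finset (Fin n)) X := by
    intro e he X hX
    rw [Finset.disjoint_right]
    intro x hx hxe
    have := (mem_nextFitIncreasing (s := s) (Finset.univ \ matched M)).1 ⟨X, hX, hx⟩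
    rw [Finset.mem_sdiff, mem_matched] at this
    exact this.2 ⟨e, he, by simpa using hxe⟩
  refine ⟨⟨matchHalfBins s M, ?_, ?_, ?_⟩, rfl, ?_⟩
  · rw [Finset.supIndep_iff_pairwiseDisjoint]
    intro X hX Y hY hXY
    rw [Finset.mem_coe, hmem] at hX hY
    change Disjoint X Y
    rcases hX with ⟨e, he, rfl⟩ | hX <;> rcases hY with ⟨e', he', rfl⟩ | hY
    · have h1 : e.1 ≠ e'.1 := fun h => hXY (by rw [hM.inj_large e he e' he' h])
      have h2 : e.2 ≠ e'.2 := fun h => hXY (by rw [hM.inj_small e he e' he' h])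
      have h3 := hM.ne he he'
      have h4 := hM.ne he' he
      simp [h1.symm, h2.symm, h3.symm, h4]
    · exact hpm e he Y hY
    · exact (hpm e' he' X hX).symm
    · exact hD.forall hX hY hXY
  · refine Finset.eq_univ_of_forall fun x => ?_
    rw [Finset.mem_sup]
    by_cases hx : x ∈ matched M
    · obtain ⟨e, he, h⟩ := mem_matched.1 hx
      exact ⟨_, (hmem _).2 (Or.inl ⟨e, he, rfl⟩), by simpa using h⟩
    · obtain ⟨X, hX, hxX⟩ := (mem_nextFitIncreasing (s := s) (Finset.univ \ matched M)).2
        (Finset.mem_sdiff.2 ⟨Finset.mem_univ x, hx⟩)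
      exact ⟨X, (hmem X).2 (Or.inr hX), hxX⟩
  · rw [hmem]
    rintro (⟨e, -, he⟩ | h)
    · simp at he
    · simpa using (hN _ h).1
  · intro X hX
    rcases (hmem X).1 hX with ⟨e, he, rfl⟩ | hX
    · rw [Finset.sum_pair (hM.ne he he)]
      exact hM.fits e he
    · exact (hN X hX).2

end Matching

/-! ### Next Fit Increasing under truncated costs -/

/-- The cost of a list of bins if a bin with `j` items costs `min j k`. -/
noncomputable def truncCost {n : ℕ} (k : ℝ) (L : List (Finset (Fin n))) : ℝ :=
  (L.map fun X => min (X.card : ℝ) k).sum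

/-- The indicator of the items that are larger than `1 / q`. -/
noncomputable def bigInd {n : ℕ} (s : Fin n → ℝ) (q : ℝ) (i : Fin n) : ℝ :=
  if 1 / q < s i then 1 else 0

/-- The size of an item in units of `1 / q`, truncated at `1`. -/
noncomputable def truncSize {n : ℕ} (s : Fin n → ℝ) (q : ℝ) (i : Fin n) : ℝ :=
  min 1 (q * s i)

section

variable {n : ℕ} {s : Fin n → ℝ}

theorem bigInd_nonneg (q : ℝ) (i : Fin n) : 0 ≤ bigInd s q i := by
  unfold bigInd; split_ifs <;> norm_num

theorem bigInd_le_truncSize (hs : ∀ i, 0 ≤ s i) {q : ℝ} (hq : 0 < q) (i : Fin n) :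
    bigInd s q i ≤ truncSize s q i := by
  unfold bigInd truncSize
  split_ifs with h
  · rw [div_lt_iff₀ hq] at h
    exact le_min le_rfl (by linarith)
  · exact le_min zero_le_one (mul_nonneg hq.le (hs i))

theorem truncCost_nextFitFrom_le {k : ℝ} (l : List (Fin n)) (B : Finset (Fin n))
    (h : Ready s B l) : truncCost k (nextFitFrom s B l) ≤ B.card + l.length := by
  induction l generalizing B with
  | nil => simp [nextFitFrom, truncCost]
  | cons i l ih =>
    rw [nextFitFrom]
    split_ifs with hf
    · have := ih _ h.insert
      rw [Finset.card_insert_of_notMem h.head_notMem] at this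
      push_cast [List.length_cons] at this ⊢
      linarith
    · have := ih _ h.next
      have hm := min_le_left (B.card : ℝ) k
      simp only [truncCost, List.map_cons, List.sum_cons, Finset.card_singleton] at this ⊢
      push_cast [List.length_cons] at this ⊢
      linarith

/-- Here `m - 1` counts the bins closed by an item of size at most `1 / q`. Each contains only such
items, so its scaled size is not truncated and is at least `q - 1`. One more bin may cost `k`; every
item after it is larger than `1 / q` and costs at most 1. The levels `k` and `q` are independent
because `k = 2` needs `q = 3`. -/
theorem truncCost_nextFitFrom_le_mul (hs : ∀ i, 0 ≤ s i) {k q : ℝ} (hq : 1 ≤ q)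
    (l : List (Fin n)) (B : Finset (Fin n)) (h : Ready s B l) :
    ∃ m : ℕ, 1 ≤ m ∧
      truncCost k (nextFitFrom s B l)
        ≤ m * k + (∑ i ∈ B, bigInd s q i + (l.map (bigInd s q)).sum) ∧
      (m - 1) * (q - 1) + (∑ i ∈ B, bigInd s q i + (l.map (bigInd s q)).sum)
        ≤ ∑ i ∈ B, truncSize s q i + (l.map (truncSize s q)).sum := by
  have hq0 : 0 < q := by linarith
  have hle : ∀ (l : List (Fin n)) (B : Finset (Fin n)),
      ∑ i ∈ B, bigInd s q i + (l.map (bigInd s q)).sum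
        ≤ ∑ i ∈ B, truncSize s q i + (l.map (truncSize s q)).sum := fun l B =>
    add_le_add (Finset.sum_le_sum fun i _ => bigInd_le_truncSize hs hq0 i)
      (List.sum_le_sum fun i _ => bigInd_le_truncSize hs hq0 i)
  have hB : ∀ B : Finset (Fin n), 0 ≤ ∑ i ∈ B, bigInd s q i := fun B =>
    Finset.sum_nonneg fun i _ => bigInd_nonneg q i
  induction l generalizing B with
  | nil =>
    refine ⟨1, le_rfl, ?_, ?_⟩
    · have h1 := hB B
      have h2 := min_le_right (B.card : ℝ) k
      simp only [nextFitFrom, truncCost, List.map_cons, List.map_nil, List.sum_cons, List.sum_nil]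
      push_cast
      linarith
    · have := hle [] B
      simpa using this
  | cons i l ih =>
    rw [nextFitFrom]
    split_ifs with hf
    · obtain ⟨m, hm, h1, h2⟩ := ih _ h.insert
      refine ⟨m, hm, ?_, ?_⟩
      · rw [Finset.sum_insert h.head_notMem] at h1
        rw [List.map_cons, List.sum_cons]
        linarith
      · rw [Finset.sum_insert h.head_notMem, Finset.sum_insert h.head_notMem] at h2
        rw [List.map_cons, List.sum_cons, List.map_cons, List.sum_cons]
        linarith
    · have hmin := min_le_right (B.card : ℝ) k
      by_cases hi : 1 / q < s i
      -- Sizes do not decrease, so all remaining items are larger than `1 / q`; only the bin being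
      -- closed is charged `k`.
      · refine ⟨1, le_rfl, ?_, ?_⟩
        · have h1 := truncCost_nextFitFrom_le (k := k) l _ h.next
          have h3 : ((i :: l).map (bigInd s q)).sum = (i :: l).length := by
            have : ∀ j ∈ i :: l, bigInd s q j = 1 := fun j hj =>
              if_pos (hi.trans_le (h.le_tail j hj))
            rw [List.map_congr_left this]
            simp [add_comm]
          have h2 := hB B
          rw [h3]
          simp only [truncCost, List.map_cons, List.sum_cons, Finset.card_singleton] at h1 ⊢
          push_cast [List.length_cons] at h1 ⊢
          linarith
        · have := hle (i :: l) B
          simpa using this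
      · obtain ⟨m, hm, h1, h2⟩ := ih _ h.next
        push Not at hi
        have hz : ∑ j ∈ B, bigInd s q j = 0 := Finset.sum_eq_zero fun j hj =>
          if_neg (not_lt.2 ((h.le j hj i List.mem_cons_self).trans hi))
        -- The item `i` does not fit and has size at most `1 / q`, so the level of `B` exceeds `1 -
        -- 1 / q`.
        have hW : q - 1 ≤ ∑ j ∈ B, truncSize s q j := by
          have : ∑ j ∈ B, truncSize s q j = q * ∑ j ∈ B, s j := by
            rw [Finset.mul_sum]
            refine Finset.sum_congr rfl fun j hj => min_eq_right ?_
            have := (h.le j hj i List.mem_cons_self).trans hi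
            rw [le_div_iff₀ hq0] at this
            linarith
          rw [this]
          rw [le_div_iff₀ hq0] at hi
          nlinarith
        refine ⟨m + 1, by omega, ?_, ?_⟩
        · rw [hz]
          rw [Finset.sum_singleton] at h1
          simp only [truncCost, List.map_cons, List.sum_cons] at h1 ⊢
          push_cast
          linarith
        · rw [hz]
          rw [Finset.sum_singleton, Finset.sum_singleton] at h2
          simp only [List.map_cons, List.sum_cons] at h1 ⊢
          push_cast
          linarith

/-- The witness is the size of the first completed bin. It consists of the smallest items and cannot
take the next one, so no feasible set has more items; every item outside it costs at most 1. -/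
theorem exists_card_le_nextFitFrom (hs : ∀ i, 0 ≤ s i) {k : ℝ} (l : List (Fin n))
    (B : Finset (Fin n)) (h : Ready s B l) :
    ∃ b : ℕ, truncCost k (nextFitFrom s B l) ≤ min (b : ℝ) k + (B.card + l.length - b) ∧
      ∀ X : Finset (Fin n), X ⊆ B ∪ l.toFinset → ∑ i ∈ X, s i ≤ 1 → X.card ≤ b := by
  induction l generalizing B with
  | nil =>
    refine ⟨B.card, ?_, fun X hX _ => Finset.card_le_card (by simpa using hX)⟩
    simp [nextFitFrom, truncCost]
  | cons i l ih =>
    rw [nextFitFrom]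
    split_ifs with hf
    · obtain ⟨b, h1, h2⟩ := ih _ h.insert
      refine ⟨b, ?_, fun X hX => h2 X (hX.trans ?_)⟩
      · rw [Finset.card_insert_of_notMem h.head_notMem] at h1
        push_cast [List.length_cons] at h1 ⊢
        linarith
      · rw [List.toFinset_cons, Finset.union_insert, Finset.insert_union]
    · refine ⟨B.card, ?_, fun X hX hX1 => ?_⟩
      · have := truncCost_nextFitFrom_le (k := k) l _ h.next
        simp only [truncCost, List.map_cons, List.sum_cons, Finset.card_singleton] at this ⊢
        push_cast [List.length_cons] at this ⊢
        linarith
      · by_contra! hc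
        have e1 := Finset.sum_sdiff_eq_sub (f := s) (Finset.inter_subset_left (s₁ := X) (s₂ := B))
        have e2 := Finset.sum_sdiff_eq_sub (f := s) (Finset.inter_subset_left (s₁ := B) (s₂ := X))
        rw [Finset.sdiff_inter_self_left] at e1 e2
        rw [Finset.inter_comm B X] at e2
        have c1 := Finset.card_sdiff_add_card_inter X B
        have c2 := Finset.card_sdiff_add_card_inter B X
        rw [Finset.inter_comm B X] at c2
        have l1 : ((X \ B).card : ℝ) * s i ≤ ∑ j ∈ X \ B, s j := by
          rw [← nsmul_eq_mul]
          refine Finset.card_nsmul_le_sum _ _ _ fun j hj => h.le_tail j ?_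
          rw [Finset.mem_sdiff] at hj
          simpa [hj.2] using hX hj.1
        have l2 : ∑ j ∈ B \ X, s j ≤ ((B \ X).card : ℝ) * s i := by
          rw [← nsmul_eq_mul]
          exact Finset.sum_le_card_nsmul _ _ _ fun j hj =>
            h.le j (Finset.mem_sdiff.1 hj).1 i List.mem_cons_self
        -- Exchange argument: items of `X \ B` are at least as large as `i` and those of `B \ X` at
        -- most as large, so one surplus item would give `X` at least the size of `B` plus that of
        -- `i`, which exceeds 1.
        have c3 : ((B \ X).card : ℝ) + 1 ≤ (X \ B).card := by
          exact_mod_cast (by omega : (B \ X).card + 1 ≤ (X \ B).card)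
        have := mul_le_mul_of_nonneg_right c3 (hs i)
        linarith

theorem sum_map_sort (J : Finset (Fin n)) (g : Fin n → ℝ) :
    ((J.sort (· ≥ ·)).map g).sum = ∑ i ∈ J, g i := by
  rw [← List.sum_toFinset g (J.sort_nodup _), Finset.sort_toFinset]

theorem truncCost_nextFitIncreasing_le_mul (hs : IsInput s) {k q : ℝ} (hk : 0 ≤ k) (hq : 1 ≤ q)
    (J : Finset (Fin n)) :
    ∃ m : ℕ, 1 ≤ m ∧
      truncCost k (nextFitIncreasing s J) ≤ m * k + ∑ i ∈ J, bigInd s q i ∧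
      (m - 1) * (q - 1) + ∑ i ∈ J, bigInd s q i ≤ ∑ i ∈ J, truncSize s q i := by
  rw [nextFitIncreasing, ← sum_map_sort J, ← sum_map_sort J]
  have h1 := sort_sorted hs.1 J
  have h2 := J.sort_nodup (· ≥ ·)
  revert h1 h2
  cases J.sort (· ≥ ·) with
  | nil => exact fun _ _ => ⟨1, le_rfl, by simpa [nextFit, truncCost] using hk, by simp⟩
  | cons i l =>
    intro h1 h2
    simpa [nextFit] using truncCost_nextFitFrom_le_mul (fun i => (hs.2 i).1) hq l {i}
      (Ready.singleton h1 h2)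

theorem exists_card_le_nextFitIncreasing (hs : IsInput s) {k : ℝ} (hk : 0 ≤ k)
    (J : Finset (Fin n)) :
    ∃ b : ℕ, truncCost k (nextFitIncreasing s J) ≤ min (b : ℝ) k + (J.card - b) ∧
      ∀ X : Finset (Fin n), X ⊆ J → ∑ i ∈ X, s i ≤ 1 → X.card ≤ b := by
  rw [nextFitIncreasing, ← J.length_sort (· ≥ ·)]
  have h1 := sort_sorted hs.1 J
  have h2 := J.sort_nodup (· ≥ ·)
  have h3 := J.sort_toFinset (· ≥ ·)
  revert h1 h2 h3
  cases J.sort (· ≥ ·) with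
  | nil =>
    rintro - - h
    refine ⟨0, by simp [nextFit, truncCost, hk], fun X hX _ => ?_⟩
    simp at h
    subst h
    simpa using hX
  | cons i l =>
    intro h1 h2 h3
    obtain ⟨b, h4, h5⟩ := exists_card_le_nextFitFrom (fun i => (hs.2 i).1) (k := k) l {i}
      (Ready.singleton h1 h2)
    refine ⟨b, ?_, fun X hX => h5 X (hX.trans ?_)⟩
    · simp only [nextFit, Finset.card_singleton] at h4 ⊢
      push_cast [List.length_cons] at h4 ⊢
      linarith
    · rw [← h3]
      simp

end

/-! ### Bounds for the weight function -/

/-- The class of a size `p > 0`: the integer `k` with `1 / (k + 1) < p ≤ 1 / k`. -/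
noncomputable def sizeClass (p : ℝ) : ℕ := ⌊1 / p⌋₊

theorem sizeClass_pos {p : ℝ} (h0 : 0 < p) (h1 : p ≤ 1) : 1 ≤ sizeClass p :=
  Nat.le_floor (by rw [Nat.cast_one, le_div_iff₀ h0]; linarith)

theorem sizeClass_mul_le {p : ℝ} (h0 : 0 < p) : (sizeClass p : ℝ) * p ≤ 1 := by
  have := Nat.floor_le (one_div_pos.2 h0).le
  rwa [le_div_iff₀ h0] at this

theorem lt_sizeClass_mul {p : ℝ} (h0 : 0 < p) : 1 < ((sizeClass p : ℝ) + 1) * p := by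
  have := Nat.lt_floor_add_one (1 / p)
  rwa [div_lt_iff₀ h0] at this

theorem sizeClass_anti {p q : ℝ} (h0 : 0 < p) (h : p ≤ q) : sizeClass q ≤ sizeClass p :=
  Nat.floor_le_floor (one_div_le_one_div_of_le h0 h)

theorem weight_of_mem {p : ℝ} (h0 : 0 < p) (h : ∃ i, sizeClass p = piSeq i - 1) :
    weight p = 1 / (sizeClass p : ℝ) := by
  rw [weight, if_neg h0.not_ge]
  exact if_pos h

theorem weight_of_notMem {p : ℝ} (h0 : 0 < p) (h : ¬ ∃ i, sizeClass p = piSeq i - 1) :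
    weight p = ((sizeClass p : ℝ) + 1) / (sizeClass p : ℝ) * p := by
  rw [weight, if_neg h0.not_ge]
  exact if_neg h

theorem one_div_sizeClass_le_weight {p : ℝ} (h0 : 0 < p) :
    1 / (sizeClass p : ℝ) ≤ weight p := by
  by_cases h : ∃ i, sizeClass p = piSeq i - 1
  · rw [weight_of_mem h0 h]
  · rw [weight_of_notMem h0 h, div_mul_eq_mul_div]
    exact div_le_div_of_nonneg_right (lt_sizeClass_mul h0).le (Nat.cast_nonneg _)

theorem weight_nonneg (p : ℝ) : 0 ≤ weight p := by
  by_cases h0 : p ≤ 0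
  · rw [weight, if_pos h0]
  · push Not at h0
    exact le_trans (by positivity) (one_div_sizeClass_le_weight h0)

theorem le_weight {p : ℝ} (h1 : p ≤ 1) : p ≤ weight p := by
  by_cases h0 : p ≤ 0
  · exact h0.trans (weight_nonneg p)
  · push Not at h0
    have hc : (0 : ℝ) < sizeClass p := by exact_mod_cast sizeClass_pos h0 h1
    refine le_trans ?_ (one_div_sizeClass_le_weight h0)
    rw [le_div_iff₀ hc, mul_comm]
    exact sizeClass_mul_le h0

/-- If `k` is the class of `p > 0`, then `1 / k ≤ (1 + 1 / k) * p`, so both branches of the weight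
are at most `(1 + 1 / k) * p`; moreover `j ≤ k`. -/
theorem weight_le {p : ℝ} {j : ℕ} (hj : 1 ≤ j) (h0 : 0 ≤ p) (hp : j * p ≤ 1) :
    weight p ≤ (1 + 1 / (j : ℝ)) * p := by
  have hj' : (0 : ℝ) < j := by exact_mod_cast hj
  rcases h0.eq_or_lt with rfl | h0
  · simp [weight]
  · have hjk : j ≤ sizeClass p := Nat.le_floor (by rwa [le_div_iff₀ h0])
    have hc : (0 : ℝ) < sizeClass p := by exact_mod_cast hj.trans hjk
    have h2 := (lt_sizeClass_mul h0).le
    have h3 : weight p ≤ (1 + 1 / (sizeClass p : ℝ)) * p := by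
      have e : (1 + 1 / (sizeClass p : ℝ)) * p = ((sizeClass p : ℝ) + 1) / sizeClass p * p := by
        field_simp
      rw [e]
      by_cases h : ∃ i, sizeClass p = piSeq i - 1
      · rw [weight_of_mem h0 h, div_mul_eq_mul_div]
        exact div_le_div_of_nonneg_right h2 hc.le
      · rw [weight_of_notMem h0 h]
    refine h3.trans (mul_le_mul_of_nonneg_right ?_ h0.le)
    have := one_div_le_one_div_of_le hj' (by exact_mod_cast hjk : (j : ℝ) ≤ sizeClass p)
    linarith

theorem weight_of_half_lt {p : ℝ} (h : 1 / 2 < p) (h1 : p ≤ 1) : weight p = 1 := by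
  have h0 : 0 < p := by linarith
  have hc : sizeClass p = 1 := by
    refine le_antisymm (Nat.lt_succ_iff.1 ?_) (sizeClass_pos h0 h1)
    rw [sizeClass, Nat.floor_lt (one_div_pos.2 h0).le, div_lt_iff₀ h0]
    push_cast
    linarith
  rw [weight_of_mem h0 ⟨0, by simp [hc, piSeq]⟩, hc]
  norm_num

theorem weight_le_half {p : ℝ} (h0 : 0 ≤ p) (h : p ≤ 1 / 2) : weight p ≤ 3 / 2 * p := by
  have := weight_le (j := 2) (by norm_num) h0 (by push_cast; linarith)
  norm_num at this
  linarith

/-! ### A potential bounding the number of Next Fit Increasing bins -/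

theorem two_pow_le_piSeq (i : ℕ) : 2 ^ i ≤ piSeq i - 1 := by
  induction i with
  | zero => simp [piSeq]
  | succ i ih =>
    have : 1 ≤ 2 ^ i := Nat.one_le_two_pow
    rw [piSeq, pow_succ, Nat.add_sub_cancel, mul_comm]
    exact Nat.mul_le_mul (by omega) ih

/-- The `i`-th term of the potential `classPotential`. -/
noncomputable def potentialTerm (j i : ℕ) : ℝ :=
  (if j ≤ piSeq i - 1 then 2 / ((piSeq i - 1 : ℕ) : ℝ) else 0) +
    (if j < piSeq i - 1 then 2 / ((piSeq i - 1 : ℕ) : ℝ) else 0)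

/-- A bounded potential of size classes that pays for the bins of Next Fit Increasing in which
the size class changes. -/
noncomputable def classPotential (j : ℕ) : ℝ :=
  2 / (j : ℝ) + ∑' i, potentialTerm j i

theorem potentialTerm_nonneg (j i : ℕ) : 0 ≤ potentialTerm j i := by
  unfold potentialTerm
  split_ifs <;> positivity

theorem potentialTerm_le (j i : ℕ) : potentialTerm j i ≤ 4 * (1 / 2) ^ i := by
  have h : 2 / ((piSeq i - 1 : ℕ) : ℝ) ≤ 2 * (1 / 2) ^ i := by
    rw [one_div_pow, ← div_eq_mul_one_div]
    exact div_le_div_of_nonneg_left (by norm_num) (by positivity)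
      (by exact_mod_cast two_pow_le_piSeq i)
  have h' : 0 ≤ 2 / ((piSeq i - 1 : ℕ) : ℝ) := by positivity
  unfold potentialTerm
  split_ifs <;> linarith

theorem potentialTerm_anti {j j' : ℕ} (h : j' ≤ j) (i : ℕ) :
    potentialTerm j i ≤ potentialTerm j' i := by
  have h' : 0 ≤ 2 / ((piSeq i - 1 : ℕ) : ℝ) := by positivity
  unfold potentialTerm
  split_ifs <;> first | omega | linarith

theorem summable_potentialTerm (j : ℕ) : Summable (potentialTerm j) :=
  Summable.of_nonneg_of_le (potentialTerm_nonneg j) (potentialTerm_le j)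
    (summable_geometric_two.mul_left 4)

theorem classPotential_nonneg (j : ℕ) : 0 ≤ classPotential j :=
  add_nonneg (by positivity) (tsum_nonneg (potentialTerm_nonneg j))

/-- The summand `2 / j` contributes at most 2, and the series at most `4 * 2` by comparison with a
geometric series. -/
theorem classPotential_le {j : ℕ} (hj : 1 ≤ j) : classPotential j ≤ 10 := by
  have h1 : ∑' i, potentialTerm j i ≤ ∑' i : ℕ, 4 * (1 / 2 : ℝ) ^ i :=
    (summable_potentialTerm j).tsum_le_tsum (potentialTerm_le j)
      (summable_geometric_two.mul_left 4)
  rw [tsum_mul_left, tsum_geometric_two] at h1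
  have h2 : 2 / (j : ℝ) ≤ 2 := div_le_self (by norm_num) (by exact_mod_cast hj)
  rw [classPotential]
  linarith

theorem classPotential_sub {j j' : ℕ} (h : j' ≤ j) :
    2 / (j' : ℝ) - 2 / (j : ℝ) ≤ classPotential j' - classPotential j := by
  have := (summable_potentialTerm j).tsum_le_tsum (potentialTerm_anti h)
    (summable_potentialTerm j')
  rw [classPotential, classPotential]
  linarith

/-- The weak and the strict indicator in `potentialTerm` make the potential jump both when the
exceptional class `piSeq i - 1` is entered and when it is left; skipping it triggers both. -/
theorem classPotential_sub_of_mem {j j' i : ℕ} (h : j' < j) (h1 : j' ≤ piSeq i - 1)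
    (h2 : piSeq i - 1 ≤ j) (h0 : 1 ≤ j') :
    2 / (j : ℝ) ≤ classPotential j' - classPotential j := by
  have hs := (summable_potentialTerm j').sub (summable_potentialTerm j)
  have h3 := hs.le_tsum i fun i _ => sub_nonneg.2 (potentialTerm_anti h.le i)
  rw [(summable_potentialTerm j').tsum_sub (summable_potentialTerm j)] at h3
  have hj : (0 : ℝ) < j' := by exact_mod_cast h0
  have h4 : 2 / (j : ℝ) ≤ 2 / (j' : ℝ) :=
    div_le_div_of_nonneg_left (by norm_num) hj (by exact_mod_cast h.le)
  have hm : (0 : ℝ) < ((piSeq i - 1 : ℕ) : ℝ) := by exact_mod_cast h0.trans h1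
  have h5 : 2 / (j : ℝ) ≤ 2 / ((piSeq i - 1 : ℕ) : ℝ) :=
    div_le_div_of_nonneg_left (by norm_num) hm (by exact_mod_cast h2)
  have h6 : 2 / ((piSeq i - 1 : ℕ) : ℝ) ≤ potentialTerm j' i - potentialTerm j i := by
    have h' : 0 ≤ 2 / ((piSeq i - 1 : ℕ) : ℝ) := by positivity
    unfold potentialTerm
    split_ifs <;> first | omega | linarith
  rw [classPotential, classPotential]
  linarith

/-- A closed bin has level above `1 - c ≥ 1 - 1 / j'`, where `j'` is the class of the next item, of
size `c`. Without a class change it has at least `j'` items of weight at least `1 / j'`. Otherwise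
the deficit is at most `1 / j'`, and the potential covers it if the class at least halves or the
range of classes meets an exceptional one. In the remaining case the factor `(k + 1) / k` in the
weights helps. -/
theorem one_le_sum_weight_add_classPotential {ι : Type*} {s : ι → ℝ} {B : Finset ι} {a c : ℝ}
    (ha : 0 < a) (hc : c ≤ 1) (hac : a ≤ c) (hB : ∀ b ∈ B, a ≤ s b ∧ s b ≤ c)
    (hsum : 1 < ∑ b ∈ B, s b + c) :
    1 ≤ ∑ b ∈ B, weight (s b) + (classPotential (sizeClass c) - classPotential (sizeClass a)) := by
  have hc0 : 0 < c := ha.trans_le hac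
  have hle : sizeClass c ≤ sizeClass a := sizeClass_anti ha hac
  have hj' : 1 ≤ sizeClass c := sizeClass_pos hc0 hc
  have hcr := sizeClass_mul_le hc0
  have hcl : ∀ b ∈ B, sizeClass c ≤ sizeClass (s b) ∧ sizeClass (s b) ≤ sizeClass a := fun b hb =>
    ⟨sizeClass_anti (ha.trans_le (hB b hb).1) (hB b hb).2, sizeClass_anti ha (hB b hb).1⟩
  set j := sizeClass a
  set j' := sizeClass c
  have hj'r : (1 : ℝ) ≤ j' := by exact_mod_cast hj'
  have hjr : (j' : ℝ) ≤ j := by exact_mod_cast hle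
  have hc' : c ≤ 1 / j' := by
    rw [le_div_iff₀ (by linarith)]
    linarith
  have hws : ∑ b ∈ B, s b ≤ ∑ b ∈ B, weight (s b) :=
    Finset.sum_le_sum fun b hb => le_weight ((hB b hb).2.trans hc)
  rcases hle.eq_or_lt with he | hlt
  · rw [he, sub_self, add_zero]
    have h1 : ∑ b ∈ B, s b ≤ B.card * c := by
      rw [← nsmul_eq_mul]
      exact Finset.sum_le_card_nsmul _ _ _ fun b hb => (hB b hb).2
    have h2 : B.card * (1 / (j' : ℝ)) ≤ ∑ b ∈ B, weight (s b) := by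
      rw [← nsmul_eq_mul]
      refine Finset.card_nsmul_le_sum _ _ _ fun b hb => ?_
      have := one_div_sizeClass_le_weight (ha.trans_le (hB b hb).1)
      rwa [le_antisymm ((hcl b hb).2.trans_eq he.symm) (hcl b hb).1] at this
    have h3 : (j' : ℝ) < B.card + 1 := by
      have h4 : 1 < (B.card + 1) * c := by linarith
      have h5 : (B.card + 1) * c ≤ (B.card + 1) * (1 / j') :=
        mul_le_mul_of_nonneg_left hc' (by positivity)
      have h6 := h4.trans_le h5
      rw [mul_one_div, lt_div_iff₀ (by linarith)] at h6
      linarith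
    have h4 : j' ≤ B.card := Nat.lt_succ_iff.1 (by exact_mod_cast h3)
    have h5 : (j' : ℝ) ≤ B.card := by exact_mod_cast h4
    refine le_trans ?_ h2
    rw [mul_one_div, le_div_iff₀ (by linarith)]
    linarith
  · have hsub := classPotential_sub hle
    by_cases h2 : 2 * j' ≤ j
    · have h2r : 2 * (j' : ℝ) ≤ j := by exact_mod_cast h2
      have h3 : 2 / (j : ℝ) ≤ 1 / j' := by
        rw [div_le_div_iff₀ (by linarith) (by linarith)]
        linarith
      have h4 : 2 / (j' : ℝ) = 1 / j' + 1 / j' := by ring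
      linarith
    · push Not at h2
      by_cases hS : ∃ i, j' ≤ piSeq i - 1 ∧ piSeq i - 1 ≤ j
      · obtain ⟨i, h3, h4⟩ := hS
        have h5 := classPotential_sub_of_mem hlt h3 h4 hj'
        have h2r : (j : ℝ) ≤ 2 * j' := by exact_mod_cast h2.le
        have h6 : 1 / (j' : ℝ) ≤ 2 / j := by
          rw [div_le_div_iff₀ (by linarith) (by linarith)]
          linarith
        linarith
      · have hw : (1 + 1 / (j : ℝ)) * ∑ b ∈ B, s b ≤ ∑ b ∈ B, weight (s b) := by
          rw [Finset.mul_sum]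
          refine Finset.sum_le_sum fun b hb => ?_
          have hb0 : 0 < s b := ha.trans_le (hB b hb).1
          rw [weight_of_notMem hb0 fun ⟨i, hi⟩ => hS ⟨i, by rw [← hi]; exact hcl b hb⟩]
          refine mul_le_mul_of_nonneg_right ?_ hb0.le
          have h3 : (j' : ℝ) ≤ sizeClass (s b) := by exact_mod_cast (hcl b hb).1
          have h4 : (sizeClass (s b) : ℝ) ≤ j := by exact_mod_cast (hcl b hb).2
          rw [add_div, div_self (by linarith)]
          have := one_div_le_one_div_of_le (by linarith) h4
          linarith
        have h3 : (j' : ℝ) + 1 ≤ j := by exact_mod_cast hlt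
        have h4 : (1 + 1 / (j : ℝ)) * (1 - 1 / j') ≤ (1 + 1 / (j : ℝ)) * ∑ b ∈ B, s b :=
          mul_le_mul_of_nonneg_left (by linarith) (by positivity)
        -- The excess over 1 is `(j - j' - 1) / (j * j')`, non-negative because the classes are
        -- distinct integers.
        have h5 : 1 ≤ (1 + 1 / (j : ℝ)) * (1 - 1 / j') + (2 / j' - 2 / j) := by
          have e : (1 + 1 / (j : ℝ)) * (1 - 1 / j') + (2 / j' - 2 / j)
              = 1 + (j - j' - 1) / (j * j') := by
            have : (j : ℝ) ≠ 0 := by linarith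
            have : (j' : ℝ) ≠ 0 := by linarith
            field_simp
            ring
          rw [e]
          have : 0 ≤ ((j : ℝ) - j' - 1) / (j * j') := div_nonneg (by linarith) (by positivity)
          linarith
        linarith

section

variable {n : ℕ} {s : Fin n → ℝ}

theorem length_nextFitFrom_le (h1 : ∀ i, s i ≤ 1) {a : ℝ} (ha : 0 < a) (ha1 : a ≤ 1)
    (l : List (Fin n)) (B : Finset (Fin n)) (h : Ready s B l) (haB : ∀ b ∈ B, a ≤ s b)
    (hal : ∀ i ∈ l, a ≤ s i) :
    ((nextFitFrom s B l).length : ℝ) ≤ 1 + (∑ i ∈ B, weight (s i) +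
      (l.map fun i => weight (s i)).sum) + (10 - classPotential (sizeClass a)) := by
  induction l generalizing B a with
  | nil =>
    have := classPotential_le (sizeClass_pos ha ha1)
    have h2 : 0 ≤ ∑ i ∈ B, weight (s i) := Finset.sum_nonneg fun i _ => weight_nonneg _
    simp [nextFitFrom]
    linarith
  | cons i l ih =>
    rw [nextFitFrom]
    split_ifs with hf
    · have := ih ha ha1 _ h.insert (Finset.forall_mem_insert _ _ _ |>.2
        ⟨hal i List.mem_cons_self, haB⟩) fun j hj => hal j (List.mem_cons_of_mem _ hj)
      rw [Finset.sum_insert h.head_notMem] at this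
      rw [List.map_cons, List.sum_cons]
      linarith
    · have hi := hal i List.mem_cons_self
      have := ih (ha.trans_le hi) (h1 i) _ h.next (by simp)
        fun j hj => h.le_tail j (List.mem_cons_of_mem _ hj)
      have hk := one_le_sum_weight_add_classPotential ha (h1 i) hi
        (fun b hb => ⟨haB b hb, h.le b hb i List.mem_cons_self⟩) (not_le.1 hf)
      rw [Finset.sum_singleton] at this
      rw [List.map_cons, List.sum_cons, List.length_cons]
      push_cast
      linarith

/-- The potential needs positive sizes. When the first bin is closed, the overflowing item is
positive, so items of size 0 matter only for that bin. The constant is 1 for the first closed bin, 1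
for the last bin and 10 for the potential. -/
theorem length_nextFitFrom_le_add (h1 : ∀ i, s i ≤ 1)
    (l : List (Fin n)) (B : Finset (Fin n)) (h : Ready s B l) (hB : ∑ i ∈ B, s i ≤ 1) :
    ((nextFitFrom s B l).length : ℝ) ≤ ∑ i ∈ B, weight (s i) +
      (l.map fun i => weight (s i)).sum + 12 := by
  have h0 : ∀ B : Finset (Fin n), 0 ≤ ∑ i ∈ B, weight (s i) := fun B =>
    Finset.sum_nonneg fun i _ => weight_nonneg _
  induction l generalizing B with
  | nil =>
    have := h0 B
    simp [nextFitFrom]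
    linarith
  | cons i l ih =>
    rw [nextFitFrom]
    split_ifs with hf
    · have := ih _ h.insert (by rw [Finset.sum_insert h.head_notMem]; linarith)
      rw [Finset.sum_insert h.head_notMem] at this
      rw [List.map_cons, List.sum_cons]
      linarith
    · have := length_nextFitFrom_le h1 (by linarith) (h1 i) l _ h.next (by simp)
        fun j hj => h.le_tail j (List.mem_cons_of_mem _ hj)
      have h2 := classPotential_nonneg (sizeClass (s i))
      have h3 := h0 B
      rw [Finset.sum_singleton] at this
      rw [List.map_cons, List.sum_cons, List.length_cons]
      push_cast
      linarith

theorem length_nextFitIncreasing_le (hs : IsInput s) (J : Finset (Fin n)) :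
    ((nextFitIncreasing s J).length : ℝ) ≤ ∑ i ∈ J, weight (s i) + 12 := by
  rw [nextFitIncreasing, ← sum_map_sort J]
  have h1 := sort_sorted hs.1 J
  have h2 := J.sort_nodup (· ≥ ·)
  revert h1 h2
  cases J.sort (· ≥ ·) with
  | nil => simp [nextFit]
  | cons i l =>
    intro h1 h2
    simpa [nextFit] using length_nextFitFrom_le_add (fun i => (hs.2 i).2) l {i}
      (Ready.singleton h1 h2) (by simpa using (hs.2 i).2)

end

/-! ### Accounting against an arbitrary packing, and truncated costs -/

section

variable {n : ℕ} {s : Fin n → ℝ}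

theorem lt_numLarge_iff (hs : Antitone s) (i : Fin n) : (i : ℕ) < numLarge s ↔ 1 / 2 < s i := by
  constructor
  · intro h
    by_contra hi
    have : (Finset.univ.filter fun i => 1 / 2 < s i) ⊆ Finset.Iio i := by
      intro j hj
      rw [Finset.mem_Iio]
      by_contra hij
      exact hi ((Finset.mem_filter.1 hj).2.trans_le (hs (not_lt.1 hij)))
    have := Finset.card_le_card this
    rw [Fin.card_Iio] at this
    exact absurd h (not_lt.2 this)
  · intro h
    have : Finset.Iic i ⊆ Finset.univ.filter fun i => 1 / 2 < s i := by
      intro j hj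
      exact Finset.mem_filter.2 ⟨Finset.mem_univ _, h.trans_le (hs (Finset.mem_Iic.1 hj))⟩
    have := Finset.card_le_card this
    rw [Fin.card_Iic] at this
    exact this

theorem numLarge_le (s : Fin n → ℝ) : numLarge s ≤ n :=
  (Finset.card_filter_le _ _).trans_eq (by simp)

theorem sum_bigInd_two (s : Fin n → ℝ) : ∑ i, bigInd s 2 i = numLarge s := by
  simp only [bigInd, Finset.sum_ite, Finset.sum_const_zero, add_zero, Finset.sum_const,
    nsmul_eq_mul, mul_one, numLarge]

theorem sum_parts (P : Partition n) (g : Fin n → ℝ) :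
    ∑ i, g i = ∑ B ∈ P.parts, ∑ i ∈ B, g i := by
  refine Eq.trans ?_ (Finset.sum_biUnion P.supIndep.pairwiseDisjoint)
  exact Finset.sum_congr P.biUnion_parts.symm fun _ _ => rfl

theorem sum_eq_sum_sdiff_matched_add {M : Finset (Fin n × Fin n)} (hM : IsMatching s M)
    (g : Fin n → ℝ) :
    ∑ i, g i = ∑ i ∈ Finset.univ \ matched M, g i + ∑ e ∈ M, (g e.1 + g e.2) := by
  rw [← Finset.sum_sdiff (Finset.subset_univ (matched M)), matched, Finset.sum_union,
    Finset.sum_image fun e he e' he' h => hM.inj_large e he e' he' h,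
    Finset.sum_image fun e he e' he' h => hM.inj_small e he e' he' h, Finset.sum_add_distrib]
  rw [Finset.disjoint_left]
  intro x h1 h2
  obtain ⟨e, he, rfl⟩ := Finset.mem_image.1 h1
  obtain ⟨e', he', h⟩ := Finset.mem_image.1 h2
  exact hM.ne he he' h.symm

theorem IsMatching.two_mul_card_le {M : Finset (Fin n × Fin n)} (hM : IsMatching s M) :
    2 * (M.card : ℝ) ≤ numLarge s + 1 := by
  have h : M.card ≤ (Finset.Ico (numLarge s / 2) (numLarge s)).card :=
    Finset.card_le_card_of_injOn (fun e => (e.1 : ℕ))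
      (fun e he => by simpa using hM.large e he)
      fun e he e' he' h => hM.inj_large e he e' he' (Fin.ext h)
  rw [Nat.card_Ico] at h
  exact_mod_cast (by omega : 2 * M.card ≤ numLarge s + 1)

/-- The cost function `min j k`. -/
noncomputable def truncFun (k : ℝ) (j : ℕ) : ℝ := min (j : ℝ) k

theorem sum_toFinset_le {ι : Type*} [DecidableEq ι] {g : ι → ℝ} (hg : ∀ i, 0 ≤ g i)
    (L : List ι) : ∑ i ∈ L.toFinset, g i ≤ (L.map g).sum := by
  induction L with
  | nil => simp
  | cons a L ih =>
    rw [List.toFinset_cons, List.map_cons, List.sum_cons]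
    by_cases h : a ∈ L.toFinset
    · rw [Finset.insert_eq_of_mem h]
      linarith [hg a]
    · rw [Finset.sum_insert h]
      linarith

theorem cost_matchHalf_le {M : Finset (Fin n × Fin n)} (hM : IsMatching s M) {P : Partition n}
    (hP : P.parts = matchHalfBins s M) {k : ℝ} (hk : 0 ≤ k) :
    cost (truncFun k) P ≤ M.card * min 2 k +
      truncCost k (nextFitIncreasing s (Finset.univ \ matched M)) := by
  have h0 : ∀ X : Finset (Fin n), 0 ≤ truncFun k X.card := fun X =>
    le_min (Nat.cast_nonneg _) hk
  have h1 : ∑ X ∈ M.image fun e => ({e.1, e.2} : Finset (Fin n)), truncFun k X.card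
      = M.card * min 2 k := by
    rw [Finset.sum_image]
    · rw [← nsmul_eq_mul, ← Finset.sum_const]
      refine Finset.sum_congr rfl fun e he => ?_
      rw [Finset.card_pair (hM.ne he he), truncFun, Nat.cast_ofNat]
    · intro e he e' he' h
      have h2 : e.1 ∈ ({e'.1, e'.2} : Finset (Fin n)) := by
        rw [← show ({e.1, e.2} : Finset (Fin n)) = {e'.1, e'.2} from h]
        simp
      rw [Finset.mem_insert, Finset.mem_singleton] at h2
      exact hM.inj_large e he e' he' (h2.resolve_right (hM.ne he he'))
  have h2 := Finset.sum_union_inter (s₁ := M.image fun e => ({e.1, e.2} : Finset (Fin n)))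
    (s₂ := (nextFitIncreasing s (Finset.univ \ matched M)).toFinset)
    (f := fun X => truncFun k X.card)
  have h3 := sum_toFinset_le h0 (nextFitIncreasing s (Finset.univ \ matched M))
  have h4 := Finset.sum_nonneg fun X (_ : X ∈ (M.image fun e => ({e.1, e.2} : Finset (Fin n))) ∩
    (nextFitIncreasing s (Finset.univ \ matched M)).toFinset) => h0 X
  rw [cost, hP, matchHalfBins]
  change _ ≤ _ + (List.map (fun X : Finset (Fin n) => truncFun k X.card) _).sum
  linarith

theorem sum_bigInd_two_le_one {B : Finset (Fin n)} (hs : ∀ i, 0 ≤ s i) (hB : ∑ i ∈ B, s i ≤ 1) :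
    ∑ i ∈ B, bigInd s 2 i ≤ 1 := by
  by_contra! h
  have h1 : ∀ i ∈ B, bigInd s 2 i ≤ 2 * s i := fun i _ =>
    (bigInd_le_truncSize hs two_pos i).trans (min_le_right _ _)
  have h2 : ∑ i ∈ B, bigInd s 2 i = ((B.filter fun i => 1 / 2 < s i).card : ℝ) := by
    simp [bigInd]
  rw [h2] at h
  have h3 : 1 < (B.filter fun i => 1 / 2 < s i).card := by exact_mod_cast h
  obtain ⟨a, ha, b, hb, hab⟩ := Finset.one_lt_card.1 h3
  rw [Finset.mem_filter] at ha hb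
  have h4 : ∑ i ∈ {a, b}, s i ≤ ∑ i ∈ B, s i :=
    Finset.sum_le_sum_of_subset_of_nonneg (by
      intro x hx
      rcases Finset.mem_insert.1 hx with rfl | hx
      · exact ha.1
      · rw [Finset.mem_singleton.1 hx]; exact hb.1) fun i _ _ => hs i
  rw [Finset.sum_pair hab] at h4
  linarith [ha.2, hb.2]

theorem sum_truncSize_le {B : Finset (Fin n)} (hB : ∑ i ∈ B, s i ≤ 1) {k : ℝ} (hk : 0 ≤ k) :
    ∑ i ∈ B, truncSize s k i ≤ min (B.card : ℝ) k := by
  refine le_min ?_ ?_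
  · refine (Finset.sum_le_card_nsmul B _ 1 fun i _ => min_le_left _ _).trans_eq ?_
    simp
  · refine (Finset.sum_le_sum fun i _ => min_le_right _ _).trans ?_
    rw [← Finset.mul_sum]
    nlinarith

theorem sum_truncSize_le_cost {O : Partition n} (hO : IsPacking s O) {k : ℝ} (hk : 0 ≤ k) :
    ∑ i, truncSize s k i ≤ cost (truncFun k) O := by
  rw [sum_parts O, cost]
  exact Finset.sum_le_sum fun B hB => sum_truncSize_le (hO B hB) hk

/-- A bin holds at most one large item and costs at least 1, and it costs `k` if it has `k` or more
items. -/
theorem numLarge_add_le_cost (hs : IsInput s) {O : Partition n} (hO : IsPacking s O) {k : ℕ}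
    (hk : 1 ≤ k) :
    (numLarge s : ℝ) + (k - 1) * ((O.parts.filter fun B => k ≤ B.card).card : ℝ)
      ≤ cost (truncFun k) O := by
  rw [← sum_bigInd_two, sum_parts O, cost, Finset.card_filter, Nat.cast_sum, Finset.mul_sum,
    ← Finset.sum_add_distrib]
  refine Finset.sum_le_sum fun B hB => ?_
  have h1 := sum_bigInd_two_le_one (fun i => (hs.2 i).1) (hO B hB)
  have h2 : (1 : ℝ) ≤ B.card := by
    exact_mod_cast Finset.card_pos.2 (O.nonempty_of_mem_parts hB)
  have h3 : (1 : ℝ) ≤ k := by exact_mod_cast hk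
  rw [truncFun]
  split_ifs with h
  · have : (k : ℝ) ≤ B.card := by exact_mod_cast h
    rw [min_eq_right this]
    push_cast
    linarith
  · simp only [Nat.cast_zero, mul_zero, add_zero]
    exact le_min (h1.trans h2) (h1.trans h3)

/-- A non-decreasing concave function that vanishes at `0` is a combination of the functions
`min j k` with non-negative coefficients. -/
theorem Valid.exists_coeff {f : ℕ → ℝ} (hf : Valid n f) :
    ∃ α : ℕ → ℝ, (∀ k ∈ Finset.Icc 1 n, 0 ≤ α k) ∧
      ∀ j ≤ n, f j = ∑ k ∈ Finset.Icc 1 n, α k * truncFun k j := by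
  -- The coefficients are the negated second differences. At `n` the last increment is taken
  -- instead, as `f (n + 1)` is unconstrained; the tail sums then telescope to the increments of
  -- `f`.
  set α : ℕ → ℝ := fun k => if k = n then f n - f (n - 1) else
    (f k - f (k - 1)) - (f (k + 1) - f k) with hα
  have htail : ∀ m i, i + m + 1 = n → ∑ k ∈ Finset.Icc (i + 1) n, α k = f (i + 1) - f i := by
    intro m
    induction m with
    | zero =>
      intro i hi
      have : i + 1 = n := hi
      subst this
      simp [hα]
    | succ m ih =>
      intro i hi
      rw [Finset.Icc_eq_cons_Ioc (by omega), Finset.sum_cons, ← Finset.Icc_succ_left_eq_Ioc,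
        Nat.succ_eq_succ, Nat.succ_eq_add_one, ih (i + 1) (by omega)]
      simp only [hα]
      rw [if_neg (by omega)]
      simp
  refine ⟨α, fun k hk => ?_, fun j hj => ?_⟩
  · rw [Finset.mem_Icc] at hk
    obtain ⟨k, rfl⟩ : ∃ k', k = k' + 1 := ⟨k - 1, by omega⟩
    simp only [hα]
    split_ifs with h
    · rw [← h]
      exact sub_nonneg.2 (hf.mono _ _ (by omega) (by omega))
    · have := hf.concave k (by omega)
      simp only [Nat.add_sub_cancel]
      linarith
  · induction j with
    | zero =>
      rw [hf.map_zero]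
      refine (Finset.sum_eq_zero fun k _ => ?_).symm
      simp [truncFun]
    | succ j ih =>
      have h1 := htail (n - j - 1) j (by omega)
      have h2 : ∑ k ∈ Finset.Icc 1 n, α k * truncFun k (j + 1) =
          ∑ k ∈ Finset.Icc 1 n, α k * truncFun k j + ∑ k ∈ Finset.Icc (j + 1) n, α k := by
        have h3 : Finset.Icc (j + 1) n = (Finset.Icc 1 n).filter fun k => j + 1 ≤ k := by
          ext k
          simp only [Finset.mem_Icc, Finset.mem_filter]
          omega
        rw [h3, Finset.sum_filter, ← Finset.sum_add_distrib]
        refine Finset.sum_congr rfl fun k _ => ?_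
        simp only [truncFun]
        split_ifs with h
        · have h4 : ((j + 1 : ℕ) : ℝ) ≤ k := by exact_mod_cast h
          rw [min_eq_left h4, min_eq_left (by push_cast at h4; linarith)]
          push_cast
          ring
        · have h4 : (k : ℝ) ≤ j := by exact_mod_cast (by omega : k ≤ j)
          rw [min_eq_right h4, min_eq_right (by push_cast; linarith)]
          ring
      rw [h2, ← ih (by omega), h1]
      ring

theorem cost_eq_sum {f : ℕ → ℝ} {α : ℕ → ℝ} {S : Finset ℕ}
    (h : ∀ j ≤ n, f j = ∑ k ∈ S, α k * truncFun k j) (P : Partition n) :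
    cost f P = ∑ k ∈ S, α k * cost (truncFun k) P := by
  simp only [cost, Finset.mul_sum]
  rw [Finset.sum_comm]
  refine Finset.sum_congr rfl fun B _ => h _ ?_
  simpa using Finset.card_le_univ B

end

/-! ### The bound for each truncation level -/

section

variable {n : ℕ} {s : Fin n → ℝ}

theorem cost_truncFun_two_le (hs : IsInput s) {M : Finset (Fin n × Fin n)} (hM : IsMatching s M)
    {P : Partition n} (hP : P.parts = matchHalfBins s M) {O : Partition n}
    (hO : IsPacking s O) :
    cost (truncFun 2) P ≤ 3 / 2 * cost (truncFun 2) O + 3 := by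
  have hs0 := fun i => (hs.2 i).1
  have h1 := cost_matchHalf_le hM hP (k := 2) (by norm_num)
  obtain ⟨m, -, h2, h3⟩ := truncCost_nextFitIncreasing_le_mul hs (k := 2) (q := 3) (by norm_num)
    (by norm_num) (Finset.univ \ matched M)
  have h4 := sum_eq_sum_sdiff_matched_add hM (truncSize s 3)
  have h5 : (M.card : ℝ) ≤ ∑ e ∈ M, (truncSize s 3 e.1 + truncSize s 3 e.2) := by
    rw [← nsmul_one, ← Finset.sum_const]
    refine Finset.sum_le_sum fun e he => ?_
    have h6 := (lt_numLarge_iff hs.1 e.1).1 (hM.large e he).2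
    have h7 : truncSize s 3 e.1 = 1 := min_eq_left (by linarith)
    have h8 : 0 ≤ truncSize s 3 e.2 := le_min zero_le_one (by linarith [hs0 e.2])
    linarith
  have h6 := hM.two_mul_card_le
  have h7 : ∑ i, (truncSize s 3 i + 1 / 2 * bigInd s 2 i) ≤ 3 / 2 * cost (truncFun 2) O := by
    rw [sum_parts O, cost, Finset.mul_sum]
    refine Finset.sum_le_sum fun B hB => ?_
    have g1 := sum_bigInd_two_le_one hs0 (hO B hB)
    have g2 : (1 : ℝ) ≤ B.card := by
      exact_mod_cast Finset.card_pos.2 (O.nonempty_of_mem_parts hB)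
    rw [Finset.sum_add_distrib, ← Finset.mul_sum, truncFun]
    have g3 : ∑ i ∈ B, truncSize s 3 i ≤ B.card :=
      (Finset.sum_le_card_nsmul B _ 1 fun i _ => min_le_left _ _).trans_eq (by simp)
    rcases le_or_gt B.card 1 with hc | hc
    · have : (B.card : ℝ) ≤ 1 := by exact_mod_cast hc
      rw [min_eq_left (by linarith)]
      linarith
    · have : (2 : ℝ) ≤ B.card := by exact_mod_cast hc
      rw [min_eq_right this]
      -- A large item contributes `1 + 1 / 2`, which is less than three times its size.
      have g4 : ∑ i ∈ B, (truncSize s 3 i + 1 / 2 * bigInd s 2 i) ≤ ∑ i ∈ B, 3 * s i := by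
        refine Finset.sum_le_sum fun i _ => ?_
        have g5 : truncSize s 3 i ≤ 1 := min_le_left _ _
        have g6 : truncSize s 3 i ≤ 3 * s i := min_le_right _ _
        unfold bigInd
        split_ifs <;> linarith
      rw [Finset.sum_add_distrib, ← Finset.mul_sum, ← Finset.mul_sum] at g4
      linarith [hO B hB]
  rw [Finset.sum_add_distrib, ← Finset.mul_sum, sum_bigInd_two] at h7
  rw [min_self] at h1
  linarith

theorem cost_truncFun_le_of_three_le (hs : IsInput s) {M : Finset (Fin n × Fin n)}
    (hM : IsMatching s M) {P : Partition n} (hP : P.parts = matchHalfBins s M) {O : Partition n}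
    (hO : IsPacking s O) {k : ℕ} (hk : 3 ≤ k) :
    cost (truncFun k) P ≤ 3 / 2 * cost (truncFun k) O + 4 := by
  have hs0 := fun i => (hs.2 i).1
  have hkr : (3 : ℝ) ≤ k := by exact_mod_cast hk
  set U := Finset.univ \ matched M with hU
  have h1 := cost_matchHalf_le hM hP (k := k) (by linarith)
  rw [min_eq_left (by linarith), ← hU] at h1
  obtain ⟨m, hm, h2, h3⟩ := truncCost_nextFitIncreasing_le_mul hs (k := k) (q := k) (by linarith)
    (by linarith) U
  have hmr : (1 : ℝ) ≤ m := by exact_mod_cast hm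
  have hlarge : ∀ e ∈ M, 1 / 2 < s e.1 := fun e he =>
    (lt_numLarge_iff hs.1 e.1).1 (hM.large e he).2
  have hsmall : ∀ e ∈ M, ¬ 1 / 2 < s e.2 := fun e he =>
    (lt_numLarge_iff hs.1 e.2).not.1 (not_lt.2 (hM.small e he))
  have h4 := sum_eq_sum_sdiff_matched_add hM (truncSize s k)
  have h5 : (M.card : ℝ) ≤ ∑ e ∈ M, (truncSize s k e.1 + truncSize s k e.2) := by
    rw [← nsmul_one, ← Finset.sum_const]
    refine Finset.sum_le_sum fun e he => ?_
    have h7 : truncSize s k e.1 = 1 := min_eq_left (by nlinarith [hlarge e he])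
    have h8 : 0 ≤ truncSize s k e.2 :=
      le_min zero_le_one (mul_nonneg (by linarith) (hs0 e.2))
    linarith
  have h6 := hM.two_mul_card_le
  have h7 : (numLarge s : ℝ) ≤ ∑ i ∈ U, bigInd s k i + M.card := by
    rw [← sum_bigInd_two, sum_eq_sum_sdiff_matched_add hM (bigInd s 2), ← nsmul_one M.card,
      ← Finset.sum_const]
    refine add_le_add (Finset.sum_le_sum fun i _ => ?_) (Finset.sum_le_sum fun e he => ?_)
    · unfold bigInd
      have : 1 / (k : ℝ) ≤ 1 / 2 := one_div_le_one_div_of_le (by norm_num) (by linarith)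
      split_ifs <;> linarith
    · rw [bigInd, bigInd, if_pos (hlarge e he), if_neg (hsmall e he), add_zero]
  have h8 := sum_truncSize_le_cost hO (k := k) (by linarith)
  have h9 := numLarge_add_le_cost hs hO (k := k) (by omega)
  set F := O.parts.filter fun B => k ≤ B.card with hF
  set C := cost (truncFun k) O
  set r := ∑ i ∈ U, bigInd s k i
  have h10 : (m - 1) * ((k : ℝ) - 1) + r + M.card ≤ C := by
    rw [← hU] at h4
    linarith
  -- The excess over `C` is at most `M.card + m + k - 1`. For `m ≥ 3`, half of `C` absorbs it up to
  -- the constant, by `(m - 3) * (k - 3) ≥ 0`.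
  rcases le_or_gt 3 m with hm3 | hm3
  · have hm3r : (3 : ℝ) ≤ m := by exact_mod_cast hm3
    nlinarith [mul_nonneg (sub_nonneg.2 hm3r) (sub_nonneg.2 hkr)]
  have hm2 : (m : ℝ) ≤ 2 := by exact_mod_cast (by omega : m ≤ 2)
  -- For `m ≤ 2`, two bins of `O` with `k` or more items contribute at least `2 * (k - 1)` to `C`
  -- beyond the number of large items.
  rcases le_or_gt 2 F.card with hF2 | hF2
  · have hF2r : (2 : ℝ) ≤ F.card := by exact_mod_cast hF2
    have h11 : ((k : ℝ) - 1) * 2 ≤ (k - 1) * F.card :=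
      mul_le_mul_of_nonneg_left hF2r (by linarith)
    linarith
  have hcard : (n : ℝ) = U.card + 2 * M.card := by
    have := sum_eq_sum_sdiff_matched_add hM fun _ => 1
    simp only [Finset.sum_const, Finset.card_univ, Fintype.card_fin, nsmul_eq_mul, mul_one] at this
    rw [this]
    ring
  obtain ⟨b, h12, h13⟩ := exists_card_le_nextFitIncreasing hs (k := k) (by linarith) U
  have hsumn : (n : ℝ) = ∑ B ∈ O.parts, (B.card : ℝ) := by
    have := sum_parts O fun _ => 1
    simpa using this
  have hC : C = n - ∑ B ∈ F, ((B.card : ℝ) - k) := by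
    rw [hsumn, hF, Finset.sum_filter, ← Finset.sum_sub_distrib]
    refine Finset.sum_congr rfl fun B _ => ?_
    rw [truncFun]
    split_ifs with h
    · rw [min_eq_right (by exact_mod_cast h)]
      ring
    · rw [min_eq_left (by exact_mod_cast (not_le.1 h).le)]
      ring
  have hmin1 := min_le_left (b : ℝ) k
  have hmin2 := min_le_right (b : ℝ) k
  -- With no such bin, `O` pays 1 per item, and no packing pays more. With a single such bin `X`, it
  -- saves `X.card - k`, while Next Fit Increasing saves at least `b - k` on its first bin.
  rcases Nat.lt_or_ge F.card 1 with hF0 | hF1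
  · rw [Finset.card_eq_zero.1 (by omega : F.card = 0), Finset.sum_empty] at hC
    have : 0 ≤ C := by rw [hC]; simp
    linarith
  · obtain ⟨X, hX⟩ := Finset.card_eq_one.1 (by omega : F.card = 1)
    have hXO : X ∈ O.parts := by
      have : X ∈ F := by rw [hX]; simp
      exact (Finset.mem_filter.1 this).1
    rw [hX, Finset.sum_singleton] at hC
    -- The unmatched items of `X` form a feasible set; its matched items are small ends of edges or
    -- its at most one large item.
    have h14 : X.card ≤ b + (M.card + 1) := by
      have hsub : X ⊆ (X ∩ U) ∪ (M.image Prod.snd ∪ X.filter fun i => 1 / 2 < s i) := by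
        intro x hx
        by_cases hxU : x ∈ U
        · exact Finset.mem_union_left _ (Finset.mem_inter.2 ⟨hx, hxU⟩)
        · have hxm : x ∈ matched M := by simpa [hU] using hxU
          obtain ⟨e, he, rfl | rfl⟩ := mem_matched.1 hxm
          · exact Finset.mem_union_right _
              (Finset.mem_union_right _ (Finset.mem_filter.2 ⟨hx, hlarge e he⟩))
          · exact Finset.mem_union_right _
              (Finset.mem_union_left _ (Finset.mem_image_of_mem _ he))
      have hXU : (X ∩ U).card ≤ b := h13 _ Finset.inter_subset_right
        ((Finset.sum_le_sum_of_subset_of_nonneg Finset.inter_subset_left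
          fun i _ _ => hs0 i).trans (hO X hXO))
      have hXl : (X.filter fun i => 1 / 2 < s i).card ≤ 1 := by
        have := sum_bigInd_two_le_one hs0 (hO X hXO)
        simp only [bigInd, Finset.sum_boole] at this
        exact_mod_cast this
      refine (Finset.card_le_card hsub).trans ((Finset.card_union_le _ _).trans ?_)
      exact add_le_add hXU ((Finset.card_union_le _ _).trans
        (add_le_add Finset.card_image_le hXl))
    have h15 : (X.card : ℝ) ≤ b + (M.card + 1) := by exact_mod_cast h14
    have h16 : (numLarge s : ℝ) ≤ C := by
      refine le_trans ?_ h9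
      exact le_add_of_nonneg_right (mul_nonneg (by linarith) (Nat.cast_nonneg _))
    linarith

/-- If the largest companion `b` has positive size and class `j`, all companions have weight at most
`1 + 1 / j` times their size, and together they have size below `1 / 2`. The claim reduces to `(1 +
1 / j) * (1 - s b) ≤ 1`, that is, `s b ≥ 1 / (j + 1)`. -/
theorem sum_weight_erase_le {B : Finset (Fin n)} (hs : ∀ i, 0 ≤ s i) (hB : ∑ i ∈ B, s i ≤ 1)
    {a b : Fin n} (ha : a ∈ B) (hal : 1 / 2 < s a) (hb : b ∈ B.erase a)
    (hmax : ∀ i ∈ B.erase a, s i ≤ s b) :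
    ∑ i ∈ B.erase a, weight (s i) ≤ 1 / 2 + 1 / 2 * weight (s b) := by
  have h1 := Finset.add_sum_erase B s ha
  have h2 := Finset.add_sum_erase (B.erase a) s hb
  have h3 := Finset.add_sum_erase (B.erase a) (fun i => weight (s i)) hb
  have h4 : 0 ≤ ∑ i ∈ (B.erase a).erase b, s i := Finset.sum_nonneg fun i _ => hs i
  rcases (hs b).eq_or_lt with hb0 | hb0
  · have : ∑ i ∈ B.erase a, weight (s i) = 0 := Finset.sum_eq_zero fun i hi => by
      rw [weight, if_pos ((hmax i hi).trans_eq hb0.symm)]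
    rw [this]
    linarith [weight_nonneg (s b)]
  · have hj := sizeClass_pos hb0 (by linarith)
    have hj2 := sizeClass_mul_le hb0
    have hj3 := lt_sizeClass_mul hb0
    set j := sizeClass (s b)
    have hjr : (1 : ℝ) ≤ j := by exact_mod_cast hj
    have hw : ∀ i ∈ B.erase a, weight (s i) ≤ (1 + 1 / (j : ℝ)) * s i := fun i hi =>
      weight_le hj (hs i) ((mul_le_mul_of_nonneg_left (hmax i hi) (by linarith)).trans hj2)
    have h5 : ∑ i ∈ (B.erase a).erase b, weight (s i)
        ≤ (1 + 1 / (j : ℝ)) * ∑ i ∈ (B.erase a).erase b, s i := by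
      rw [Finset.mul_sum]
      exact Finset.sum_le_sum fun i hi => hw i (Finset.mem_of_mem_erase hi)
    have h6 := hw b hb
    have h7 : (1 + 1 / (j : ℝ)) * ∑ i ∈ (B.erase a).erase b, s i
        ≤ (1 + 1 / (j : ℝ)) * (1 / 2 - s b) :=
      mul_le_mul_of_nonneg_left (by linarith) (by positivity)
    have h8 : (1 + 1 / (j : ℝ)) * (1 - s b) ≤ 1 := by
      have e : 1 + 1 / (j : ℝ) = (j + 1) / j := by field_simp
      rw [e, div_mul_eq_mul_div, div_le_one (by linarith)]
      linarith
    linarith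

/-- Each of the `⌊t/2⌋` largest items is paired with one of the `⌊t/2⌋` smallest large items. The
better partner of the two fits with the smaller item of the pair, so at least half of the value
survives. For odd `t` the middle item is dropped, losing at most 1. -/
theorem exists_isMatching_of_partners (hs : IsInput s) (v : Fin n → ℝ) (b : Fin n → Fin n)
    (hv0 : ∀ i, 0 ≤ v i) (hv1 : ∀ i, v i ≤ 1)
    (hb : ∀ a, 1 / 2 < s a → 0 < v a → s a + s (b a) ≤ 1 ∧ v a ≤ weight (s (b a)))
    (hinj : ∀ a a', 1 / 2 < s a → 1 / 2 < s a' → 0 < v a → 0 < v a' → b a = b a' → a = a') :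
    ∃ M, IsMatching s M ∧
      ∑ i, bigInd s 2 i * v i ≤ 2 * ∑ e ∈ M, weight (s e.2) + 1 := by
  set t := numLarge s with ht
  have htn : t ≤ n := numLarge_le s
  set h := t / 2 with hh
  set hi : Fin h → Fin n := fun j => ⟨j, by omega⟩ with hhi
  set lo : Fin h → Fin n := fun j => ⟨t - h + j, by omega⟩ with hlo
  set C : Fin h → Fin n := fun j => if v (hi j) ≤ v (lo j) then lo j else hi j with hC
  have hloL : ∀ j, 1 / 2 < s (lo j) := fun j => (lt_numLarge_iff hs.1 _).1 (by simp [hlo]; omega)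
  have hhiL : ∀ j, 1 / 2 < s (hi j) := fun j => (lt_numLarge_iff hs.1 _).1 (by simp [hhi]; omega)
  have hCL : ∀ j, 1 / 2 < s (C j) := fun j => by
    simp only [hC]; split_ifs
    · exact hloL j
    · exact hhiL j
  have hloC : ∀ j, s (lo j) ≤ s (C j) := fun j => by
    simp only [hC]; split_ifs
    · exact le_rfl
    · exact hs.1 (Fin.le_def.2 (by simp [hlo, hhi]))
  have hCv : ∀ j, v (hi j) + v (lo j) ≤ 2 * v (C j) := fun j => by
    simp only [hC]; split_ifs <;> linarith
  have hCinj : ∀ j j', C j = C j' → j = j' := by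
    intro j j' hjj
    have : (C j : ℕ) = C j' := by rw [hjj]
    simp only [hC] at this
    ext
    split_ifs at this <;> simp [hlo, hhi] at this <;> omega
  have hloinj : ∀ j j', lo j = lo j' → j = j' := by
    intro j j' hjj
    simp [hlo] at hjj
    exact Fin.ext hjj
  set J := Finset.univ.filter fun j => 0 < v (C j) with hJ
  have hJv : ∀ j ∈ J, 0 < v (C j) := fun j hj => (Finset.mem_filter.1 hj).2
  refine ⟨J.image fun j => (lo j, b (C j)), ?_, ?_⟩
  · constructor
    · intro e he
      obtain ⟨j, hj, rfl⟩ := Finset.mem_image.1 he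
      simp only [hlo]
      omega
    · intro e he
      obtain ⟨j, hj, rfl⟩ := Finset.mem_image.1 he
      have h1 := (hb _ (hCL j) (hJv j hj)).1
      have h2 := hCL j
      by_contra! hlt
      have := (lt_numLarge_iff hs.1 _).1 hlt
      simp only at this
      linarith
    · intro e he
      obtain ⟨j, hj, rfl⟩ := Finset.mem_image.1 he
      have h1 := (hb _ (hCL j) (hJv j hj)).1
      have h2 := hloC j
      simp only
      linarith
    · intro e he e' he' hee
      obtain ⟨j, hj, rfl⟩ := Finset.mem_image.1 he
      obtain ⟨j', hj', rfl⟩ := Finset.mem_image.1 he'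
      rw [hloinj j j' hee]
    · intro e he e' he' hee
      obtain ⟨j, hj, rfl⟩ := Finset.mem_image.1 he
      obtain ⟨j', hj', rfl⟩ := Finset.mem_image.1 he'
      rw [hCinj j j' (hinj _ _ (hCL j) (hCL j') (hJv j hj) (hJv j' hj') hee)]
  · rw [Finset.sum_image fun j _ j' _ h => hloinj j j' (congrArg Prod.fst h)]
    have h1 : ∑ j, v (C j) ≤ ∑ j ∈ J, weight (s (b (C j))) := by
      have : ∑ j ∈ J, v (C j) = ∑ j, v (C j) :=
        Finset.sum_filter_of_ne fun j _ hne => lt_of_le_of_ne (hv0 _) (Ne.symm hne)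
      rw [← this]
      exact Finset.sum_le_sum fun j hj => (hb _ (hCL j) (hJv j hj)).2
    have h2 : ∑ j, (v (hi j) + v (lo j)) ≤ ∑ j, 2 * v (C j) :=
      Finset.sum_le_sum fun j _ => hCv j
    rw [Finset.sum_add_distrib, ← Finset.mul_sum] at h2
    set V : ℕ → ℝ := fun j => if hj : j < n then v ⟨j, hj⟩ else 0 with hV
    have hV1 : ∀ j, V j ≤ 1 := fun j => by
      simp only [hV]; split_ifs
      · exact hv1 _
      · exact zero_le_one
    have h3 : ∑ i, bigInd s 2 i * v i = ∑ j ∈ Finset.range t, V j := by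
      have e1 : ∑ i, bigInd s 2 i * v i = ∑ i : Fin n, if (i : ℕ) < t then V i else 0 := by
        refine Finset.sum_congr rfl fun i _ => ?_
        simp only [bigInd, ← lt_numLarge_iff hs.1 i, hV, i.2, dite_true, Fin.eta]
        split_ifs <;> simp
      rw [e1, Fin.sum_univ_eq_sum_range (fun j => if j < t then V j else 0) n,
        ← Finset.sum_filter]
      congr 1
      ext j
      simp only [Finset.mem_filter, Finset.mem_range]
      omega
    have h4 : ∑ j, v (hi j) = ∑ j ∈ Finset.range h, V j := by
      rw [← Fin.sum_univ_eq_sum_range]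
      refine Finset.sum_congr rfl fun j _ => ?_
      simp only [hV, hhi]
      rw [dif_pos]
    have h5 : ∑ j, v (lo j) = ∑ j ∈ Finset.range h, V (t - h + j) := by
      rw [← Fin.sum_univ_eq_sum_range (fun j => V (t - h + j))]
      refine Finset.sum_congr rfl fun j _ => ?_
      simp only [hV, hlo]
      rw [dif_pos]
    have h6 : ∑ j ∈ Finset.range (t - h), V j ≤ ∑ j ∈ Finset.range h, V j + 1 := by
      rcases (by omega : t - h = h ∨ t - h = h + 1) with e | e
      · rw [e]
        linarith
      · rw [e, Finset.sum_range_succ]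
        linarith [hV1 h]
    have h7 : ∑ j ∈ Finset.range t, V j
        = ∑ j ∈ Finset.range (t - h), V j + ∑ j ∈ Finset.range h, V (t - h + j) := by
      rw [← Finset.sum_range_add]
      congr 2
      omega
    linarith

theorem cost_truncFun_one_le (hs : IsInput s) {M : Finset (Fin n × Fin n)}
    (hM : IsMaxMatching s M) {P : Partition n} (hP : P.parts = matchHalfBins s M)
    {O : Partition n} (hO : IsPacking s O) :
    cost (truncFun 1) P ≤ 3 / 2 * cost (truncFun 1) O + 13 := by
  have hs0 := fun i => (hs.2 i).1
  have hs1 := fun i => (hs.2 i).2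
  have hpart : ∀ a, O.part a ∈ O.parts := fun a => O.part_mem.2 (Finset.mem_univ a)
  have hmem : ∀ a, a ∈ O.part a := fun a => O.mem_part (Finset.mem_univ a)
  have hex : ∀ a, ∃ b, ((O.part a).erase a).Nonempty →
      b ∈ (O.part a).erase a ∧ ∀ i ∈ (O.part a).erase a, s i ≤ s b := by
    intro a
    by_cases h : ((O.part a).erase a).Nonempty
    · obtain ⟨b, hb⟩ := Finset.exists_max_image _ s h
      exact ⟨b, fun _ => hb⟩
    · exact ⟨a, fun h' => absurd h' h⟩
  choose b hb using hex
  -- The weight of the largest companion of a large item in its bin of `O`, and 0 if there is none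
  -- or the item is not large.
  set v : Fin n → ℝ := fun a =>
    if ((O.part a).erase a).Nonempty ∧ 1 / 2 < s a then weight (s (b a)) else 0 with hv
  have hpair : ∀ a, ((O.part a).erase a).Nonempty → s a + s (b a) ≤ 1 := by
    intro a ha
    have h1 := Finset.add_sum_erase (O.part a) s (hmem a)
    have h2 := Finset.single_le_sum (f := s) (fun i _ => hs0 i) (hb a ha).1
    linarith [hO _ (hpart a)]
  have hvpos : ∀ a, 0 < v a → ((O.part a).erase a).Nonempty := by
    intro a ha
    by_contra h
    simp only [hv] at ha
    rw [if_neg fun h' => h h'.1] at ha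
    exact lt_irrefl _ ha
  obtain ⟨M', hM', h1⟩ := exists_isMatching_of_partners hs v b
    (fun a => by simp only [hv]; split_ifs <;> [exact weight_nonneg _; exact le_rfl])
    (fun a => by
      simp only [hv]
      split_ifs with h
      · have := hpair a h.1
        have := weight_le_half (hs0 (b a)) (by linarith [h.2])
        linarith
      · exact zero_le_one)
    (fun a ha hva => ⟨hpair a (hvpos a hva), by
      simp only [hv]; split_ifs <;> [exact le_rfl; exact weight_nonneg _]⟩)
    -- A common companion would put two large items into one bin of `O`.
    (fun a a' ha ha' hva hva' hbb => by
      have h2 := Finset.mem_of_mem_erase (hb a (hvpos a hva)).1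
      have h3 := Finset.mem_of_mem_erase (hb a' (hvpos a' hva')).1
      rw [hbb] at h2
      have h4 : O.part a = O.part a' := by
        rw [← O.part_eq_of_mem (hpart a) h2, ← O.part_eq_of_mem (hpart a') h3]
      by_contra hne
      have h5 : a' ∈ (O.part a).erase a :=
        Finset.mem_erase.2 ⟨Ne.symm hne, by rw [h4]; exact hmem a'⟩
      have h6 := (hb a ⟨a', h5⟩).2 a' h5
      linarith [hpair a ⟨a', h5⟩])
  have h2 := hM.2 M' hM'
  have h3 := cost_matchHalf_le hM.1 hP (k := 1) zero_le_one
  rw [min_eq_right (by norm_num), mul_one] at h3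
  have h4 : truncCost 1 (nextFitIncreasing s (Finset.univ \ matched M))
      ≤ (nextFitIncreasing s (Finset.univ \ matched M)).length := by
    rw [truncCost]
    refine (List.sum_le_card_nsmul _ 1 ?_).trans_eq (by simp)
    intro x hx
    obtain ⟨X, -, rfl⟩ := List.mem_map.1 hx
    exact min_le_right _ _
  have h5 := length_nextFitIncreasing_le hs (Finset.univ \ matched M)
  have h6 := sum_eq_sum_sdiff_matched_add hM.1 fun i => weight (s i)
  have h7 : ∑ e ∈ M, (weight (s e.1) + weight (s e.2)) = M.card + ∑ e ∈ M, weight (s e.2) := by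
    rw [Finset.sum_add_distrib, Finset.sum_congr rfl fun e he =>
      weight_of_half_lt ((lt_numLarge_iff hs.1 e.1).1 (hM.1.large e he).2) (hs1 e.1)]
    simp
  -- A bin with a large item has weight at most `1 + 1 / 2` after the credit for its companion; in a
  -- bin without one, weights are at most 3/2 times the sizes.
  have h8 : ∑ i, (weight (s i) - 1 / 2 * (bigInd s 2 i * v i)) ≤ 3 / 2 * cost (truncFun 1) O := by
    rw [sum_parts O, cost, Finset.mul_sum]
    refine Finset.sum_le_sum fun B hB => ?_
    have g2 : (1 : ℝ) ≤ B.card := by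
      exact_mod_cast Finset.card_pos.2 (O.nonempty_of_mem_parts hB)
    rw [truncFun, min_eq_right g2, mul_one]
    by_cases hl : ∃ a ∈ B, 1 / 2 < s a
    · obtain ⟨a, haB, hal⟩ := hl
      have hBa : O.part a = B := O.part_eq_of_mem hB haB
      rw [← Finset.add_sum_erase B _ haB, weight_of_half_lt hal (hs1 a)]
      have g3 : ∑ i ∈ B.erase a, (weight (s i) - 1 / 2 * (bigInd s 2 i * v i))
          ≤ ∑ i ∈ B.erase a, weight (s i) := by
        refine Finset.sum_le_sum fun i _ => sub_le_self _ ?_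
        refine mul_nonneg (by norm_num) (mul_nonneg (bigInd_nonneg 2 i) ?_)
        simp only [hv]
        split_ifs <;> [exact weight_nonneg _; exact le_rfl]
      have g4 : bigInd s 2 a = 1 := if_pos hal
      rw [g4, one_mul]
      by_cases hR : (B.erase a).Nonempty
      · have hR' : ((O.part a).erase a).Nonempty := by rwa [hBa]
        have g5 := hb a hR'
        rw [hBa] at g5
        have g6 := sum_weight_erase_le hs0 (hO B hB) haB hal g5.1 g5.2
        have g7 : v a = weight (s (b a)) := if_pos ⟨hR', hal⟩
        rw [g7]
        linarith
      · rw [Finset.not_nonempty_iff_eq_empty.1 hR] at g3 ⊢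
        have : 0 ≤ v a := by
          simp only [hv]
          split_ifs <;> [exact weight_nonneg _; exact le_rfl]
        simp only [Finset.sum_empty]
        linarith
    · push Not at hl
      have g3 : ∑ i ∈ B, (weight (s i) - 1 / 2 * (bigInd s 2 i * v i)) ≤ ∑ i ∈ B, 3 / 2 * s i := by
        refine Finset.sum_le_sum fun i hi => ?_
        rw [bigInd, if_neg (not_lt.2 (hl i hi))]
        linarith [weight_le_half (hs0 i) (hl i hi)]
      rw [← Finset.mul_sum] at g3
      linarith [hO B hB]
  rw [Finset.sum_sub_distrib, ← Finset.mul_sum] at h8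
  linarith

theorem cost_truncFun_le (hs : IsInput s) {M : Finset (Fin n × Fin n)}
    (hM : IsMaxMatching s M) {P : Partition n} (hP : P.parts = matchHalfBins s M)
    {O : Partition n} (hO : IsPacking s O) {k : ℕ} (hk : 1 ≤ k) :
    cost (truncFun k) P ≤ 3 / 2 * cost (truncFun k) O + 13 := by
  rcases (by omega : k = 1 ∨ k = 2 ∨ 3 ≤ k) with rfl | rfl | hk
  · simpa using cost_truncFun_one_le hs hM hP hO
  · have := cost_truncFun_two_le hs hM.1 hP hO
    push_cast
    linarith
  · have := cost_truncFun_le_of_three_le hs hM.1 hP hO hk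
    linarith

/-! ### From truncations to all valid cost functions -/

theorem cost_matchHalf_le_opt (hn : 1 ≤ n) (hs : IsInput s) {f : ℕ → ℝ} (hf : Valid n f)
    {P : Partition n} (hP : P ∈ matchHalf s) :
    cost f P ≤ 3 / 2 * opt f s + 13 * f 1 := by
  obtain ⟨M, hM, hP⟩ := hP
  obtain ⟨O, hO, hOf⟩ := (opt_isLeast f s hs).1
  obtain ⟨α, hα, hfα⟩ := hf.exists_coeff
  have h1 : f 1 = ∑ k ∈ Finset.Icc 1 n, α k := by
    rw [hfα 1 hn]
    refine Finset.sum_congr rfl fun k hk => ?_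
    have : (1 : ℝ) ≤ k := by exact_mod_cast (Finset.mem_Icc.1 hk).1
    rw [truncFun, Nat.cast_one, min_eq_left this, mul_one]
  rw [← hOf, cost_eq_sum hfα P, cost_eq_sum hfα O, h1, Finset.mul_sum, Finset.mul_sum,
    ← Finset.sum_add_distrib]
  refine Finset.sum_le_sum fun k hk => ?_
  have := mul_le_mul_of_nonneg_left
    (cost_truncFun_le hs hM hP hO (Finset.mem_Icc.1 hk).1) (hα k hk)
  linarith

theorem cost_eq_zero (f : ℕ → ℝ) (P : Partition 0) : cost f P = 0 := by
  rw [cost]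
  refine Finset.sum_eq_zero fun B hB => ?_
  obtain ⟨x, -⟩ := P.nonempty_of_mem_parts hB
  exact x.elim0

theorem asymptoticRatio_matchHalf_le {F : ℕ → Set (ℕ → ℝ)} (hF : ∀ n, ∀ f ∈ F n, Valid n f)
    {c : ℝ} (hc0 : 0 ≤ c) (hc : ∀ n, ∀ f ∈ F n, f 1 ≤ c) :
    asymptoticRatio matchHalf F ≤ ((3 / 2 : ℝ) : EReal) := by
  refine sInf_le ⟨3 / 2, ⟨by norm_num, 13 * c, ?_⟩, rfl⟩
  intro n s hs f hf P hP
  -- For `n = 0` validity says nothing about `f 1`, but all costs vanish.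
  rcases Nat.eq_zero_or_pos n with rfl | hn
  · obtain ⟨O, -, hOf⟩ := (opt_isLeast f s hs).1
    rw [← hOf, cost_eq_zero, cost_eq_zero]
    linarith
  · have := cost_matchHalf_le_opt hn hs (hF n f hf) hP
    linarith [hc n f hf]

end

end GCBP

theorem mainTheorem2 :
    -- MatchHalf is a well-defined algorithm: whichever maximum matching is used (there is one),
    -- its bins form a packing of all items
    (∀ (n : ℕ) (s : Fin n → ℝ), GCBP.IsInput s →
      (∃ M, GCBP.IsMaxMatching s M) ∧
      ∀ M, GCBP.IsMaxMatching s M →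
        ∃ P : GCBP.Partition n, P.parts = GCBP.matchHalfBins s M ∧ GCBP.IsPacking s P) ∧
    -- its asymptotic approximation ratio, over all instances with a valid cost function
    -- normalized by `f 1 = 1`, is at most `3 / 2`
    GCBP.asymptoticRatio GCBP.matchHalf (fun n => {f | GCBP.Valid n f ∧ f 1 = 1})
      ≤ ((3 / 2 : ℝ) : EReal) ∧
    -- so is the ratio for every fixed valid cost function, normalized or not
    (∀ f : ℕ → ℝ, (∀ n, GCBP.Valid n f) →
      GCBP.asymptoticRatio GCBP.matchHalf (fun _ => {f}) ≤ ((3 / 2 : ℝ) : EReal)) ∧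
    -- and `3 / 2` itself is attained, with one constant for all valid cost functions
    (∃ c : ℝ, ∀ (n : ℕ), 1 ≤ n → ∀ (s : Fin n → ℝ), GCBP.IsInput s → ∀ f : ℕ → ℝ, GCBP.Valid n f →
      ∀ P ∈ GCBP.matchHalf s,
        GCBP.cost f P ≤ 3 / 2 * GCBP.opt f s + c * f 1) := by
  refine ⟨fun n s hs => ⟨GCBP.exists_isMaxMatching s, fun M hM =>
    GCBP.exists_partition_matchHalfBins hs hM.1⟩, ?_, fun f hf => ?_,
    13, fun n hn s hs f hf P hP => GCBP.cost_matchHalf_le_opt hn hs hf hP⟩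
  · exact GCBP.asymptoticRatio_matchHalf_le (fun n f hf => hf.1) zero_le_one
      fun n f hf => hf.2.le
  · refine GCBP.asymptoticRatio_matchHalf_le (c := f 1) (fun n g hg => ?_) ?_ fun n g hg => ?_
    · rw [Set.mem_singleton_iff.1 hg]
      exact hf n
    · rw [← (hf 1).map_zero]
      exact (hf 1).mono 0 1 zero_le_one le_rfl
    · rw [Set.mem_singleton_iff.1 hg]
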